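/- Let $\mathcal{SG}$ be the Sierpinski gasket, the unique nonempty compact set with $\mathcal{SG}=\bigcup_{j=0}^2F_j\mathcal{SG}$, $F_jx=(x+q_j)/2$, where $q_0$ (top), $q_1$ (bottom left), $q_2$ (bottom right) are the vertices of an equilateral triangle, and let $V_0=\{q_0,q_1,q_2\}$. A cell of level $m$ is a set $F_w\mathcal{SG}$ with $F_w=F_{w_1}\circ\cdots\circ F_{w_m}$, $w\in\{0,1,2\}^m$; its edges are the three pairs $\{F_wq_i,F_wq_j\}$, $i\ne j$. Let $\Omega$ be the set of points of $\mathcal{SG}\setminus V_0$ strictly to the left of the vertical symmetry line, let $X=\{x_m\}_{m\ge1}$, $x_m=F_0^{m-1}F_2q_1$, be the set of points of $\mathcal{SG}\setminus V_0$ on that line, and let $\overline\Omega=\Omega\cup\{q_0,q_1\}\cup X$. For $D\subseteq\mathcal{SG}$ put $$\mathcal E_{D,m}(u,v)=\Big(\frac53\Big)^m\sum_{x\sim y}(u(x)-u(y))(v(x)-v(y)),$$ the sum being over the edges of all cells of level $m$ contained in $D$, and $\mathcal E_D(u)=\lim_{m\to\infty}\mathcal E_{D,m}(u,u)\in[0,\infty]$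 (a nondecreasing limit). For $u:\overline\Omega\to\mathbb R$ write $\mathcal E(u)=\mathcal E_{\overline\Omega}(u)$, and write $u\in\operatorname{dom}\mathcal E$ if $\mathcal E(u)<\infty$. With $\mu$ the symmetric self-similar probability measure on $\mathcal{SG}$, $\triangle u=f$ on $\Omega$ means that $u$ and $f$ are continuous on $\Omega$, that $u$ has finite energy on every cell contained in $\Omega$, and that $\lim_{m\to\infty}\mathcal E_{\Omega,m}(u,v)=-\int fv\,d\mu$ for every continuous $v$ on $\mathcal{SG}$ with $\mathcal E_{\mathcal{SG}}(v)<\infty$ that vanishes outside a compact subset of $\Omega$. **Theorem.** There is a constant $C$ such that the following holds. Let $(a_m)_{m\ge0}$ be real numbers with $a_m\to A$, and let $u\in C(\overline\Omega)$ solve the boundary value problem $$\triangle u=0\ \text{ on }\Omega,\qquad u(q_1)=a_0,\qquad u(x_m)=a_m\quad(m\ge1).$$ Then $u\in\operatorname{dom}\mathcal E$ if and only if the sequence $\big((5/3)^{m/2}(a_m-A)\big)_{m\ge0}$ lies in $\ell^2$. Moreover $$\mathcal E(u)\le C\,\big\|(5/3)^{m/2}(a_m-A)\big\|_{\ell^2}^2=C\sum_{m=0}^\infty\Big(\frac53\Big)^m(a_m-A)^2,$$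 where both sides may be infinite. -/

import Mathlib

open Filter Topology MeasureTheory
open scoped ENNReal NNReal

noncomputable section

namespace HalfGasket

/-- The Euclidean plane. -/
abbrev Plane : Type := EuclideanSpace ℝ (Fin 2)

/-- The vertices of an equilateral triangle: `q 0` on top, `q 1` bottom left, `q 2` bottom
right. -/
def q : Fin 3 → Plane :=
  ![!₂[1 / 2, Real.sqrt 3 / 2], !₂[0, 0], !₂[1, 0]]

/-- The contractions `F_j x = (x + q_j) / 2`. -/
def F (j : Fin 3) (x : Plane) : Plane := (1 / 2 : ℝ) • (x + q j)

/-- The point with address `ω`, that is `∑ n, q (ω n) / 2 ^ (n + 1)`. -/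
def code (ω : ℕ → Fin 3) : Plane := ∑' n : ℕ, ((1 / 2 : ℝ) ^ (n + 1)) • q (ω n)

/-- The Sierpinski gasket. By `isSelfSimilar_SG` and `eq_SG` below it is the unique nonempty
compact set `K` with `K = F_0 K ∪ F_1 K ∪ F_2 K`. -/
def SG : Set Plane := Set.range code

/-- The standard measure on `SG` (the symmetric self-similar probability measure): the law of
`code ω` when the digits of the address `ω` are independent and uniform on `{0, 1, 2}`. -/
def stdMeasure : Measure Plane :=
  (Measure.infinitePi fun _ : ℕ => (PMF.uniformOfFintype (Fin 3)).toMeasure).map code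

/-- The set `V_0`, the boundary of the gasket. -/
def V₀ : Set Plane := Set.range q

/-- `cellMap w = F_{w 0} ∘ F_{w 1} ∘ ⋯ ∘ F_{w (m-1)}` for a word `w` of length `m`. -/
def cellMap : {m : ℕ} → (Fin m → Fin 3) → Plane → Plane
  | 0, _, x => x
  | _ + 1, w, x => F (w 0) (cellMap (fun i => w i.succ) x)

/-- The cell `F_w SG` of level `m`, where `m` is the length of the word `w`. -/
def cell {m : ℕ} (w : Fin m → Fin 3) : Set Plane := cellMap w '' SG

open Classical in
/-- The renormalized graph energy form of level `m` on a subset `D` of the gasket,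
`(5/3)^m ∑ (u x - u y) (v x - v y)`, the sum being over the edges `x ∼ y` of all the cells of
level `m` contained in `D`. For `D = SG` these are all the edges of the graph `Γ_m`. -/
def graphForm (D : Set Plane) (m : ℕ) (u v : Plane → ℝ) : ℝ :=
  (5 / 3 : ℝ) ^ m * ∑ w : Fin m → Fin 3 with cell w ⊆ D, ∑ i : Fin 3,
    (u (cellMap w (q i)) - u (cellMap w (q (i + 1)))) *
      (v (cellMap w (q i)) - v (cellMap w (q (i + 1))))

/-- The energy on `D`, with values in `[0, ∞]`: the supremum of the graph energies of level `m`,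
which is also their limit as `m → ∞`, see `tendsto_energy`. -/
def energy (D : Set Plane) (u : Plane → ℝ) : ℝ≥0∞ :=
  ⨆ m : ℕ, ENNReal.ofReal (graphForm D m u u)

/-- Test functions on a relatively open subset `U` of the gasket: continuous functions of finite
energy on `SG` vanishing outside a compact subset of `U`. -/
def IsTestFunction (U : Set Plane) (v : Plane → ℝ) : Prop :=
  ContinuousOn v SG ∧ energy SG v < ∞ ∧ ∃ K ⊆ U, IsCompact K ∧ ∀ x ∈ SG \ K, v x = 0

/-- `Δ u = f` on the relatively open subset `U` of the gasket, where `Δ` is the (Kigami) Laplacian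
with respect to the standard measure, in its weak formulation: `u` and `f` are continuous on `U`,
`u` has locally finite energy, and `E(u, v) = - ∫ f v` for all test functions `v` on `U`. -/
def HasLaplacianOn (U : Set Plane) (u f : Plane → ℝ) : Prop :=
  ContinuousOn u U ∧ ContinuousOn f U ∧
  (∀ (m : ℕ) (w : Fin m → Fin 3), cell w ⊆ U → energy (cell w) u < ∞) ∧
  ∀ v : Plane → ℝ, IsTestFunction U v →
    Tendsto (fun m => graphForm U m u v) atTop (𝓝 (-∫ x, f x * v x ∂stdMeasure))

/-- The domain `Ω`: the part of the gasket strictly to the left of its vertical symmetry line,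
without the points of `V_0`. -/
def Ω : Set Plane := {x | x ∈ SG \ V₀ ∧ x 0 < 1 / 2}

/-- The part `X` of the gasket on its vertical symmetry line, without the points of `V_0`. -/
def X : Set Plane := {x | x ∈ SG \ V₀ ∧ x 0 = 1 / 2}

/-- `Ω` together with its boundary `{q_0} ∪ {q_1} ∪ X`. -/
def closedΩ : Set Plane := Ω ∪ ({q 0, q 1} ∪ X)

/-- The points `x_m = F_0^(m-1) F_2 q_1` of `X`, for `m ≥ 1`. -/
def xPt (m : ℕ) : Plane := (F 0)^[m - 1] (F 2 (q 1))

/-- `u` solves the boundary value problem `Δ u = 0` on `Ω`, `u (q_1) = a_0`, `u (x_m) = a_m` for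
`m ≥ 1`. -/
def SolvesBVP (a : ℕ → ℝ) (u : Plane → ℝ) : Prop :=
  HasLaplacianOn Ω u (fun _ => 0) ∧ u (q 1) = a 0 ∧ ∀ m : ℕ, 1 ≤ m → u (xPt m) = a m

/-! Checks of the definitions. -/

theorem norm_q_le : ∃ B : ℝ, ∀ j, ‖q j‖ ≤ B :=
  ⟨∑ j, ‖q j‖, fun j => Finset.single_le_sum (f := fun j => ‖q j‖)
    (fun _ _ => norm_nonneg _) (Finset.mem_univ j)⟩

theorem summable_geom (B : ℝ) : Summable fun n : ℕ => (1 / 2 : ℝ) ^ (n + 1) * B :=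
  ((summable_nat_add_iff 1).2 summable_geometric_two).mul_right B

theorem summable_code (ω : ℕ → Fin 3) :
    Summable fun n : ℕ => ((1 / 2 : ℝ) ^ (n + 1)) • q (ω n) := by
  obtain ⟨B, hB⟩ := norm_q_le
  refine Summable.of_norm_bounded (summable_geom B) fun n => ?_
  rw [norm_smul, Real.norm_of_nonneg (by positivity)]
  gcongr
  exact hB _

theorem continuous_code : Continuous code := by
  obtain ⟨B, hB⟩ := norm_q_le
  change Continuous fun ω : ℕ → Fin 3 => ∑' n : ℕ, ((1 / 2 : ℝ) ^ (n + 1)) • q (ω n)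
  refine continuous_tsum (fun n => ?_) (summable_geom B) fun n ω => ?_
  · have hq : Continuous q := continuous_of_discreteTopology
    fun_prop
  · rw [norm_smul, Real.norm_of_nonneg (by positivity)]
    gcongr
    exact hB _

theorem isCompact_SG : IsCompact SG := isCompact_range continuous_code

instance : IsProbabilityMeasure stdMeasure :=
  Measure.isProbabilityMeasure_map continuous_code.measurable.aemeasurable

theorem code_eq (ω : ℕ → Fin 3) : code ω = F (ω 0) (code fun n => ω (n + 1)) := by
  unfold code F
  rw [(summable_code ω).tsum_eq_zero_add, smul_add, add_comm, ← (summable_code _).tsum_const_smul]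
  congr 1
  · refine tsum_congr fun n => ?_
    rw [smul_smul, pow_succ' _ (n + 1)]
  · simp

theorem isSelfSimilar_SG : SG.Nonempty ∧ IsCompact SG ∧ SG = ⋃ j, F j '' SG := by
  refine ⟨⟨_, fun _ => 0, rfl⟩, isCompact_SG, ?_⟩
  ext x
  simp only [Set.mem_iUnion]
  constructor
  · rintro ⟨ω, rfl⟩
    exact ⟨ω 0, _, ⟨_, rfl⟩, (code_eq ω).symm⟩
  · rintro ⟨j, _, ⟨ω, rfl⟩, rfl⟩
    refine ⟨fun n => if n = 0 then j else ω (n - 1), ?_⟩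
    rw [code_eq]
    simp

theorem dist_F (j : Fin 3) (x y : Plane) : dist (F j x) (F j y) = 1 / 2 * dist x y := by
  unfold F
  rw [dist_smul₀, dist_add_right]
  norm_num

theorem subset_of_selfSimilar {K L : Set Plane} (hK : IsCompact K) (hL : IsCompact L)
    (hne : L.Nonempty) (hK' : K = ⋃ j, F j '' K) (hL' : L = ⋃ j, F j '' L) : K ⊆ L := by
  obtain ⟨B, hB⟩ := Metric.isBounded_iff.1 (hK.isBounded.union hL.isBounded)
  have key : ∀ (n : ℕ), ∀ x ∈ K, ∃ y ∈ L, dist x y ≤ (1 / 2 : ℝ) ^ n * B := by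
    intro n
    induction n with
    | zero =>
      intro x hx
      obtain ⟨y, hy⟩ := hne
      exact ⟨y, hy, by simpa using hB (Or.inl hx) (Or.inr hy)⟩
    | succ n ih =>
      intro x hx
      rw [hK'] at hx
      obtain ⟨j, x', hx', rfl⟩ := Set.mem_iUnion.1 hx
      obtain ⟨y, hy, hd⟩ := ih x' hx'
      refine ⟨F j y, ?_, ?_⟩
      · rw [hL']
        exact Set.mem_iUnion.2 ⟨j, y, hy, rfl⟩
      · rw [dist_F, pow_succ]
        linarith
  intro x hx
  rw [← hL.isClosed.closure_eq, Metric.mem_closure_iff]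
  intro ε hε
  have hlim : Tendsto (fun n : ℕ => (1 / 2 : ℝ) ^ n * B) atTop (𝓝 (0 * B)) :=
    (tendsto_pow_atTop_nhds_zero_of_lt_one (by norm_num) (by norm_num)).mul_const B
  rw [zero_mul] at hlim
  obtain ⟨n, hn⟩ := (hlim.eventually_lt_const hε).exists
  obtain ⟨y, hy, hd⟩ := key n x hx
  exact ⟨y, hy, hd.trans_lt hn⟩

theorem eq_SG {K : Set Plane} (hne : K.Nonempty) (hK : IsCompact K)
    (h : K = ⋃ j, F j '' K) : K = SG :=
  (subset_of_selfSimilar hK isCompact_SG isSelfSimilar_SG.1 h isSelfSimilar_SG.2.2).antisymm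
    (subset_of_selfSimilar isCompact_SG hK hne isSelfSimilar_SG.2.2 h)

theorem cellMap_snoc : ∀ {m : ℕ} (w : Fin m → Fin 3) (j : Fin 3) (x : Plane),
    cellMap (Fin.snoc w j : Fin (m + 1) → Fin 3) x = cellMap w (F j x)
  | 0, _, _, _ => rfl
  | m + 1, w, j, x => by
    have h0 : (Fin.snoc w j : Fin (m + 2) → Fin 3) 0 = w 0 :=
      Fin.snoc_castSucc (α := fun _ => Fin 3) j w 0
    have h1 : (fun i : Fin (m + 1) => (Fin.snoc w j : Fin (m + 2) → Fin 3) i.succ) =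
        Fin.snoc (fun i => w i.succ) j := by
      funext i
      refine Fin.lastCases ?_ (fun i => ?_) i
      · rw [Fin.succ_last, Fin.snoc_last, Fin.snoc_last]
      · rw [Fin.succ_castSucc, Fin.snoc_castSucc, Fin.snoc_castSucc]
    change F ((Fin.snoc w j : Fin (m + 2) → Fin 3) 0)
      (cellMap (fun i : Fin (m + 1) => (Fin.snoc w j : Fin (m + 2) → Fin 3) i.succ) x) = _
    rw [h0, h1, cellMap_snoc]
    rfl

theorem cell_snoc_subset {m : ℕ} (w : Fin m → Fin 3) (j : Fin 3) :
    cell (Fin.snoc w j : Fin (m + 1) → Fin 3) ⊆ cell w := by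
  rintro _ ⟨x, hx, rfl⟩
  refine ⟨F j x, ?_, (cellMap_snoc w j x).symm⟩
  rw [isSelfSimilar_SG.2.2]
  exact Set.mem_iUnion.2 ⟨j, x, hx, rfl⟩

theorem F_self (j : Fin 3) : F j (q j) = q j := by
  rw [F, ← two_smul ℝ, smul_smul]
  norm_num

theorem F_comm (i j : Fin 3) : F i (q j) = F j (q i) := by
  rw [F, F, add_comm]

theorem graphForm_mono (D : Set Plane) (u : Plane → ℝ) :
    Monotone fun m => graphForm D m u u := by
  classical
  refine monotone_nat_of_le_succ fun m => ?_
  unfold graphForm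
  rw [pow_succ, mul_assoc]
  refine mul_le_mul_of_nonneg_left ?_ (by positivity)
  rw [Finset.sum_filter, Finset.sum_filter, Finset.mul_sum,
    ← (Fin.snocEquiv fun _ : Fin (m + 1) => Fin 3).sum_comp, Fintype.sum_prod_type_right]
  refine Finset.sum_le_sum fun w _ => ?_
  split_ifs with hw
  · have hs : ∀ j, cell (Fin.snoc w j : Fin (m + 1) → Fin 3) ⊆ D :=
      fun j => (cell_snoc_subset w j).trans hw
    have e : ∀ j, (Fin.snocEquiv fun _ : Fin (m + 1) => Fin 3) (j, w) = Fin.snoc w j :=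
      fun j => rfl
    simp only [e, hs, if_true, cellMap_snoc, Fin.sum_univ_three, Fin.isValue, zero_add,
      show (1 : Fin 3) + 1 = 2 from rfl, show (2 : Fin 3) + 1 = 0 from rfl, F_self,
      F_comm 1 0, F_comm 2 0, F_comm 2 1]
    generalize u (cellMap w (q 0)) = p0
    generalize u (cellMap w (q 1)) = p1
    generalize u (cellMap w (q 2)) = p2
    generalize u (cellMap w (F 0 (q 1))) = r2
    generalize u (cellMap w (F 0 (q 2))) = r1
    generalize u (cellMap w (F 1 (q 2))) = r0
    nlinarith [sq_nonneg (r0 - (p0 + 2 * p1 + 2 * p2) / 5),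
      sq_nonneg (r1 - (2 * p0 + p1 + 2 * p2) / 5), sq_nonneg (r2 - (2 * p0 + 2 * p1 + p2) / 5),
      sq_nonneg ((r0 - (p0 + 2 * p1 + 2 * p2) / 5) - (r1 - (2 * p0 + p1 + 2 * p2) / 5)),
      sq_nonneg ((r1 - (2 * p0 + p1 + 2 * p2) / 5) - (r2 - (2 * p0 + 2 * p1 + p2) / 5)),
      sq_nonneg ((r2 - (2 * p0 + 2 * p1 + p2) / 5) - (r0 - (p0 + 2 * p1 + 2 * p2) / 5))]
  · refine Finset.sum_nonneg fun j _ => mul_nonneg (by norm_num) ?_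
    split_ifs
    · exact Finset.sum_nonneg fun i _ => mul_self_nonneg _
    · exact le_rfl

theorem tendsto_energy (D : Set Plane) (u : Plane → ℝ) :
    Tendsto (fun m => ENNReal.ofReal (graphForm D m u u)) atTop (𝓝 (energy D u)) :=
  tendsto_atTop_iSup fun _ _ h => ENNReal.ofReal_le_ofReal (graphForm_mono D u h)

end HalfGasket

end

/-!
The closed half gasket is the union of the cells `C_k = F_0 ^ k F_1 SG`, `k ≥ 0`, and of the point
`q_0`. The vertices of `C_k` are `F_0 ^ k q_1`, `F_0 ^ (k + 1) q_1` and `x_(k + 1)`.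

*Reduction to a recurrence.* A solution `u` is weakly harmonic in `C_k` away from the three
vertices, and continuous on `C_k`. Points have positive capacity in the gasket, so this already
forces `u` to be on `C_k` the harmonic function with the same vertex values
(`eqOn_harmonicExt`): if `φ` is the difference of the two, the truncation `(φ - ε)⁺` vanishes near
the vertices, so it is an admissible test function, and its energy is at most its energy product
with `φ`, which is `0`. The harmonic functions themselves are limits of functions glued together
by the `1/5`-`2/5` rule, and their energy product with any `v` is determined at level zero
(`graphForm_harmonicExt`). Hence the energy of `u` is the sum over `k` of `(5/3) ^ (k + 1)` times
the triangle energy of the vertex values on `C_k` (`IsHarmonicΩ.graphForm_closedΩ`). Testing with a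
bump function at the common vertex of `C_k` and `C_(k + 1)` shows that the normal derivatives
cancel there (`IsHarmonicΩ.flux`), which is a recurrence for the values
`s_k = u (F_0 ^ k q_1)`:
`16 s_(k + 1) = 3 s_k + 5 s_(k + 2) + 3 a_(k + 1) + 5 a_(k + 2)`.

*The recurrence.* After subtraction of the limit `A = u (q_0)` the sequence `s` tends to zero. The
homogeneous recurrence has the characteristic roots `3` and `1/5`, on either side of
`(3/5) ^ (1/2)`, and the root `3` does not contribute to a solution that tends to zero. Therefore
the weighted square sum of `s` is controlled by the one of `a`
(`sum_pow_mul_sq_le_of_recurrence`), and so is the energy. Conversely, finite energy bounds the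
weighted square sum of the increments of `s`, hence the one of `s` by a Hardy inequality
(`hardy_sum_le`), hence the one of `a`.

By self-similarity all this is proved for the cell `F_1 SG` and transported to `C_k` by passing
from `u` to `u ∘ F 0`, which is harmonic on `Ω` again (`IsHarmonicΩ.comp_F_zero`).
-/

open Filter Topology MeasureTheory
open scoped ENNReal NNReal

noncomputable section

namespace HalfGasket

/-! ### Barycentric coordinates and the geometry of the gasket -/

/-- The barycentric coordinates of a point of the plane with respect to the triangle `q`. -/
def bary (i : Fin 3) (x : Plane) : ℝ :=
  ![2 * x 1 / √3, 1 - x 0 - x 1 / √3, x 0 - x 1 / √3] i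

theorem continuous_bary (i : Fin 3) : Continuous (bary i) := by
  fin_cases i
  · change Continuous fun x : Plane => 2 * x 1 / √3
    fun_prop
  · change Continuous fun x : Plane => 1 - x 0 - x 1 / √3
    fun_prop
  · change Continuous fun x : Plane => x 0 - x 1 / √3
    fun_prop

theorem bary_q (i j : Fin 3) : bary i (q j) = if i = j then 1 else 0 := by
  have h : √3 ≠ 0 := by positivity
  fin_cases i <;> fin_cases j <;> simp [bary, q] <;> field_simp <;> norm_num

theorem bary_F (i j : Fin 3) (x : Plane) :
    bary i (F j x) = (bary i x + if i = j then 1 else 0) / 2 := by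
  have h : √3 ≠ 0 := by positivity
  rw [← bary_q]
  fin_cases i <;> simp [bary, F] <;> ring

theorem sum_bary (x : Plane) : bary 0 x + bary 1 x + bary 2 x = 1 := by
  simp [bary]; ring

theorem ext_bary {x y : Plane} (h : ∀ i, bary i x = bary i y) : x = y := by
  have h3 : √3 ≠ 0 := by positivity
  have h0 := h 0
  have h2 := h 2
  simp only [bary, Matrix.cons_val] at h0 h2
  have e1 : x 1 = y 1 := by field_simp at h0; linarith
  have e0 : x 0 = y 0 := by rw [e1] at h2; linarith
  ext i
  fin_cases i
  · exact e0
  · exact e1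

theorem coord_zero (x : Plane) : x 0 = 1 / 2 + (bary 2 x - bary 1 x) / 2 := by
  simp [bary]; ring

theorem F_mem_SG (j : Fin 3) {x : Plane} (hx : x ∈ SG) : F j x ∈ SG := by
  rw [isSelfSimilar_SG.2.2]
  exact Set.mem_iUnion.2 ⟨j, x, hx, rfl⟩

theorem exists_eq_F {x : Plane} (hx : x ∈ SG) : ∃ j, ∃ y ∈ SG, F j y = x := by
  rw [isSelfSimilar_SG.2.2] at hx
  simpa using hx

theorem bary_nonneg (i : Fin 3) {x : Plane} (hx : x ∈ SG) : 0 ≤ bary i x := by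
  obtain ⟨z, hz, hmin⟩ := isCompact_SG.exists_isMinOn isSelfSimilar_SG.1
    (continuous_bary i).continuousOn
  refine le_trans ?_ (hmin hx)
  obtain ⟨j, y, hy, rfl⟩ := exists_eq_F hz
  have h1 : bary i (F j y) ≤ bary i y := hmin hy
  rw [bary_F] at h1 ⊢
  split_ifs at h1 ⊢ <;> linarith

theorem bary_le_one (i : Fin 3) {x : Plane} (hx : x ∈ SG) : bary i x ≤ 1 := by
  have := sum_bary x
  have h0 := bary_nonneg 0 hx
  have h1 := bary_nonneg 1 hx
  have h2 := bary_nonneg 2 hx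
  fin_cases i <;> simp only [Fin.zero_eta, Fin.mk_one, Fin.reduceFinMk] <;> linarith

theorem eq_q_of_bary {i : Fin 3} {x : Plane} (hx : x ∈ SG) (h : 1 ≤ bary i x) : x = q i := by
  have := sum_bary x
  have h0 := bary_nonneg 0 hx
  have h1 := bary_nonneg 1 hx
  have h2 := bary_nonneg 2 hx
  refine ext_bary fun k => ?_
  rw [bary_q]
  fin_cases i <;> fin_cases k <;>
    simp only [Fin.zero_eta, Fin.mk_one, Fin.reduceFinMk, Fin.isValue, Fin.reduceEq,
      if_true, if_false] at h ⊢ <;> linarith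

theorem q_mem_SG (i : Fin 3) : q i ∈ SG := by
  refine ⟨fun _ => i, ?_⟩
  have h := code_eq fun _ => i
  refine ext_bary fun k => ?_
  have h' := congrArg (bary k) h
  rw [bary_F] at h'
  rw [bary_q]
  linarith

theorem F_injective (j : Fin 3) : Function.Injective (F j) := by
  intro x y h
  have := dist_F j x y
  rw [h, dist_self] at this
  exact dist_eq_zero.1 (by linarith)

/-- Two different cells of level one meet in at most one point, a vertex of both. -/
theorem eq_q_of_F_eq {i j : Fin 3} (hij : i ≠ j) {x y : Plane} (hx : x ∈ SG) (hy : y ∈ SG)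
    (h : F i x = F j y) : y = q i := by
  have h' := congrArg (bary i) h
  rw [bary_F, bary_F, if_pos rfl, if_neg hij] at h'
  have := bary_nonneg i hx
  exact eq_q_of_bary hy (by linarith)

theorem continuous_F (j : Fin 3) : Continuous (F j) := by
  unfold F; fun_prop

theorem cellMap_cons {m : ℕ} (j : Fin 3) (w : Fin m → Fin 3) (x : Plane) :
    cellMap (Fin.cons j w : Fin (m + 1) → Fin 3) x = F j (cellMap w x) := rfl

theorem cell_cons {m : ℕ} (j : Fin 3) (w : Fin m → Fin 3) :
    cell (Fin.cons j w : Fin (m + 1) → Fin 3) = F j '' cell w := by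
  rw [cell, cell, Set.image_image]
  rfl

theorem cellMap_mem_SG : ∀ {m : ℕ} (w : Fin m → Fin 3) {x : Plane}, x ∈ SG → cellMap w x ∈ SG
  | 0, _, _, hx => hx
  | _ + 1, w, _, hx => F_mem_SG (w 0) (cellMap_mem_SG (fun i => w i.succ) hx)

theorem cell_subset_SG {m : ℕ} (w : Fin m → Fin 3) : cell w ⊆ SG := by
  rintro _ ⟨x, hx, rfl⟩
  exact cellMap_mem_SG w hx

theorem dist_cellMap : ∀ {m : ℕ} (w : Fin m → Fin 3) (x y : Plane),
    dist (cellMap w x) (cellMap w y) = (1 / 2) ^ m * dist x y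
  | 0, _, _, _ => by simp [cellMap]
  | m + 1, w, x, y => by
    change dist (F _ _) (F _ _) = _
    rw [dist_F, dist_cellMap]
    ring

theorem tendsto_half_pow_mul (B : ℝ) :
    Tendsto (fun n : ℕ => (1 / 2 : ℝ) ^ n * B) atTop (𝓝 0) := by
  simpa using (tendsto_pow_atTop_nhds_zero_of_lt_one (r := (1 / 2 : ℝ)) (by norm_num)
    (by norm_num)).mul_const B

/-- Cells of high level are uniformly small. -/
theorem eventually_cell_small {δ : ℝ} (hδ : 0 < δ) : ∀ᶠ m : ℕ in atTop,
    ∀ w : Fin m → Fin 3, ∀ x ∈ cell w, ∀ y ∈ cell w, dist x y < δ := by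
  obtain ⟨B, hB⟩ := Metric.isBounded_iff.1 isCompact_SG.isBounded
  filter_upwards [(tendsto_half_pow_mul B).eventually_lt_const hδ] with m hm w
  rintro _ ⟨x, hx, rfl⟩ _ ⟨y, hy, rfl⟩
  rw [dist_cellMap]
  refine lt_of_le_of_lt ?_ hm
  gcongr
  exact hB hx hy

theorem exists_mem_cell : ∀ (m : ℕ) {x : Plane}, x ∈ SG → ∃ w : Fin m → Fin 3, x ∈ cell w
  | 0, x, hx => ⟨Fin.elim0, x, hx, rfl⟩
  | m + 1, x, hx => by
    obtain ⟨j, y, hy, rfl⟩ := exists_eq_F hx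
    obtain ⟨w, hw⟩ := exists_mem_cell m hy
    refine ⟨Fin.cons j w, ?_⟩
    rw [cell_cons]
    exact ⟨y, hw, rfl⟩

theorem cellMap_q_mem_cell {m : ℕ} (w : Fin m → Fin 3) (i : Fin 3) : cellMap w (q i) ∈ cell w :=
  ⟨_, q_mem_SG i, rfl⟩

/-- The vertices of the cells are dense in the gasket. -/
theorem eqOn_zero_of_vertices {f : Plane → ℝ} (hf : ContinuousOn f SG)
    (h : ∀ (m : ℕ) (w : Fin m → Fin 3) (i : Fin 3), f (cellMap w (q i)) = 0) :
    ∀ x ∈ SG, f x = 0 := by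
  intro x hx
  choose w hw using fun m => exists_mem_cell m hx
  have hlim : Tendsto (fun m => cellMap (w m) (q 0)) atTop (𝓝[SG] x) := by
    refine tendsto_nhdsWithin_iff.2
      ⟨?_, Eventually.of_forall fun m => cellMap_mem_SG _ (q_mem_SG 0)⟩
    refine Metric.tendsto_nhds.2 fun ε hε => ?_
    filter_upwards [eventually_cell_small hε] with m hm
    exact hm (w m) _ (cellMap_q_mem_cell _ _) _ (hw m)
  have h2 := (hf x hx).tendsto.comp hlim
  have h3 : (f ∘ fun m => cellMap (w m) (q 0)) = fun _ => 0 := funext fun m => h m _ _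
  rw [h3] at h2
  exact tendsto_nhds_unique h2 tendsto_const_nhds

/-! ### The domain and its closure -/

theorem mem_closedΩ {x : Plane} : x ∈ closedΩ ↔ x ∈ SG ∧ bary 2 x ≤ bary 1 x := by
  have hc := coord_zero x
  constructor
  · rintro (⟨⟨h, -⟩, h'⟩ | (rfl | rfl) | ⟨⟨h, -⟩, h'⟩)
    · exact ⟨h, by linarith⟩
    · exact ⟨q_mem_SG _, by simp [bary_q]⟩
    · exact ⟨q_mem_SG _, by simp [bary_q]⟩
    · exact ⟨h, by linarith⟩
  · rintro ⟨h, h'⟩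
    by_cases hV : x ∈ V₀
    · obtain ⟨i, rfl⟩ := hV
      fin_cases i
      · exact Or.inr (Or.inl (Or.inl rfl))
      · exact Or.inr (Or.inl (Or.inr rfl))
      · simp [bary_q] at h'
        norm_num at h'
    · rcases h'.lt_or_eq with h' | h'
      · exact Or.inl ⟨⟨h, hV⟩, by linarith⟩
      · exact Or.inr (Or.inr ⟨⟨h, hV⟩, by rw [hc, h']; ring⟩)

theorem mem_Ω {x : Plane} : x ∈ Ω ↔ x ∈ SG ∧ bary 2 x < bary 1 x ∧ bary 1 x < 1 := by
  have hc := coord_zero x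
  constructor
  · rintro ⟨⟨h, hV⟩, h'⟩
    refine ⟨h, by linarith, lt_of_not_ge fun h1 => hV ?_⟩
    exact ⟨1, (eq_q_of_bary h h1).symm⟩
  · rintro ⟨h, h', h1⟩
    refine ⟨⟨h, ?_⟩, by linarith⟩
    rintro ⟨i, rfl⟩
    rw [bary_q] at h1
    rw [bary_q, bary_q] at h'
    fin_cases i
    · simp at h'
    · simp at h1
    · simp at h'
      norm_num at h'

/-! ### Self-similarity of the graph energies -/

theorem graphForm_succ (D : Set Plane) (m : ℕ) (u v : Plane → ℝ) :
    graphForm D (m + 1) u v =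
      5 / 3 * ∑ j : Fin 3, graphForm (F j ⁻¹' D) m (u ∘ F j) (v ∘ F j) := by
  classical
  unfold graphForm
  rw [pow_succ', mul_assoc, ← Finset.mul_sum]
  congr 2
  rw [Finset.sum_filter, ← (Fin.consEquiv fun _ : Fin (m + 1) => Fin 3).sum_comp,
    Fintype.sum_prod_type]
  refine Finset.sum_congr rfl fun j _ => ?_
  rw [Finset.sum_filter]
  refine Finset.sum_congr rfl fun w _ => ?_
  have e : (Fin.consEquiv fun _ : Fin (m + 1) => Fin 3) (j, w) = Fin.cons j w := rfl
  simp only [e, cell_cons, Set.image_subset_iff, cellMap_cons, Function.comp]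

theorem graphForm_congr_set {D D' : Set Plane} {m : ℕ}
    (h : ∀ w : Fin m → Fin 3, cell w ⊆ D ↔ cell w ⊆ D') (u v : Plane → ℝ) :
    graphForm D m u v = graphForm D' m u v := by
  classical
  unfold graphForm
  congr 2
  exact Finset.filter_congr fun w _ => h w

theorem graphForm_congr {u u' v v' : Plane → ℝ} (hu : Set.EqOn u u' SG) (hv : Set.EqOn v v' SG)
    (D : Set Plane) (m : ℕ) : graphForm D m u v = graphForm D m u' v' := by
  unfold graphForm
  simp only [hu (cellMap_mem_SG _ (q_mem_SG _)), hv (cellMap_mem_SG _ (q_mem_SG _))]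

theorem graphForm_SG_succ (m : ℕ) (u v : Plane → ℝ) :
    graphForm SG (m + 1) u v = 5 / 3 * ∑ j : Fin 3, graphForm SG m (u ∘ F j) (v ∘ F j) := by
  rw [graphForm_succ]
  congr 1
  refine Finset.sum_congr rfl fun j _ => graphForm_congr_set (fun w => ?_) _ _
  exact ⟨fun _ => cell_subset_SG w, fun h x hx => F_mem_SG j (h hx)⟩

/-- The energy form of a triangle. -/
def triForm (b c : Fin 3 → ℝ) : ℝ := ∑ i : Fin 3, (b i - b (i + 1)) * (c i - c (i + 1))

theorem triForm_eq (b c : Fin 3 → ℝ) : triForm b c =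
    (b 0 - b 1) * (c 0 - c 1) + (b 1 - b 2) * (c 1 - c 2) + (b 2 - b 0) * (c 2 - c 0) := by
  simp only [triForm, Fin.sum_univ_three]
  rfl

theorem graphForm_eq (m : ℕ) (u v : Plane → ℝ) : graphForm SG m u v =
    (5 / 3) ^ m * ∑ w : Fin m → Fin 3,
      triForm (fun i => u (cellMap w (q i))) (fun i => v (cellMap w (q i))) := by
  classical
  unfold graphForm triForm
  rw [Finset.filter_true_of_mem fun w _ => cell_subset_SG w]

theorem graphForm_zero (u v : Plane → ℝ) : graphForm SG 0 u v = triForm (u ∘ q) (v ∘ q) := by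
  rw [graphForm_eq]
  simp [cellMap, Function.comp_def]

theorem graphForm_self_nonneg (D : Set Plane) (m : ℕ) (u : Plane → ℝ) :
    0 ≤ graphForm D m u u := by
  classical
  exact mul_nonneg (by positivity)
    (Finset.sum_nonneg fun w _ => Finset.sum_nonneg fun i _ => mul_self_nonneg _)

theorem energy_lt_top_iff {D : Set Plane} {u : Plane → ℝ} :
    energy D u < ∞ ↔ ∃ B : ℝ, ∀ m, graphForm D m u u ≤ B := by
  constructor
  · intro h
    refine ⟨(energy D u).toReal, fun m => ?_⟩
    have h1 : ENNReal.ofReal (graphForm D m u u) ≤ energy D u := le_iSup (fun m =>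
      ENNReal.ofReal (graphForm D m u u)) m
    exact (ENNReal.ofReal_le_iff_le_toReal h.ne).1 h1
  · rintro ⟨B, hB⟩
    exact lt_of_le_of_lt (iSup_le fun m => ENNReal.ofReal_le_ofReal (hB m)) ENNReal.ofReal_lt_top

theorem energy_congr {u v : Plane → ℝ} (h : Set.EqOn u v SG) (D : Set Plane) :
    energy D u = energy D v := by
  exact iSup_congr fun m => by rw [graphForm_congr h h]

/-- A function has finite energy if its restrictions to the cells of level one do. -/
theorem energy_lt_top_of_comp_F {u : Plane → ℝ} (h : ∀ j, energy SG (u ∘ F j) < ∞) :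
    energy SG u < ∞ := by
  choose B hB using fun j => energy_lt_top_iff.1 (h j)
  refine energy_lt_top_iff.2 ⟨5 / 3 * ∑ j, B j, fun m => ?_⟩
  refine (graphForm_mono SG u m.le_succ).trans ?_
  simp only
  rw [graphForm_SG_succ]
  gcongr with j
  exact hB j m

theorem energy_lt_top_of_comp_cellMap : ∀ (n : ℕ) {u : Plane → ℝ},
    (∀ w : Fin n → Fin 3, energy SG (u ∘ cellMap w) < ∞) → energy SG u < ∞
  | 0, _, h => h Fin.elim0
  | n + 1, _, h => energy_lt_top_of_comp_F fun j =>
      energy_lt_top_of_comp_cellMap n fun w => h (Fin.cons j w)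

theorem graphForm_comp_cellMap_le : ∀ {n : ℕ} (w : Fin n → Fin 3) (D : Set Plane) (m : ℕ)
    (u : Plane → ℝ), cell w ⊆ D → graphForm SG m (u ∘ cellMap w) (u ∘ cellMap w) ≤
      graphForm D (m + n) u u
  | 0, w, D, m, u, h => by
    refine (graphForm_congr_set (fun w' => ?_) _ _).le
    refine ⟨fun hw' => hw'.trans ?_, fun _ => cell_subset_SG w'⟩
    simpa [cell, cellMap] using h
  | n + 1, w, D, m, u, h => by
    rw [← add_assoc, graphForm_succ]
    have h1 : cell (fun i => w i.succ) ⊆ F (w 0) ⁻¹' D := by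
      rw [← Set.image_subset_iff, ← cell_cons]
      convert h using 2
      exact Fin.cons_self_tail w
    have h2 := graphForm_comp_cellMap_le (fun i => w i.succ) _ m (u ∘ F (w 0)) h1
    have h3 := Finset.single_le_sum (f := fun j => graphForm (F j ⁻¹' D) (m + n) (u ∘ F j)
      (u ∘ F j)) (fun j _ => graphForm_self_nonneg _ _ _) (Finset.mem_univ (w 0))
    have h4 := graphForm_self_nonneg SG m (u ∘ cellMap w)
    change graphForm SG m (u ∘ cellMap w) (u ∘ cellMap w) ≤ _ at h2
    linarith

theorem energy_comp_cellMap_lt_top {n : ℕ} {w : Fin n → Fin 3} {D : Set Plane} {u : Plane → ℝ}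
    (hw : cell w ⊆ D) (h : energy D u < ∞) : energy SG (u ∘ cellMap w) < ∞ := by
  obtain ⟨B, hB⟩ := energy_lt_top_iff.1 h
  exact energy_lt_top_iff.2 ⟨B, fun m => (graphForm_comp_cellMap_le w D m u hw).trans (hB _)⟩

theorem graphForm_add_left (D : Set Plane) (m : ℕ) (u u' v : Plane → ℝ) :
    graphForm D m (u + u') v = graphForm D m u v + graphForm D m u' v := by
  simp only [graphForm, ← mul_add, ← Finset.sum_add_distrib, Pi.add_apply]
  congr 1
  refine Finset.sum_congr rfl fun w _ => Finset.sum_congr rfl fun i _ => ?_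
  ring

theorem graphForm_comm (D : Set Plane) (m : ℕ) (u v : Plane → ℝ) :
    graphForm D m u v = graphForm D m v u := by
  simp only [graphForm, mul_comm]

theorem graphForm_neg_left (D : Set Plane) (m : ℕ) (u v : Plane → ℝ) :
    graphForm D m (-u) v = -graphForm D m u v := by
  have h := graphForm_add_left D m u (-u) v
  rw [add_neg_cancel] at h
  have h0 : graphForm D m 0 v = 0 := by simp [graphForm]
  linarith

theorem energy_neg (D : Set Plane) (u : Plane → ℝ) : energy D (-u) = energy D u :=
  iSup_congr fun m => by
    rw [graphForm_neg_left, graphForm_comm, graphForm_neg_left, neg_neg]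

theorem energy_add_lt_top {D : Set Plane} {u v : Plane → ℝ} (hu : energy D u < ∞)
    (hv : energy D v < ∞) : energy D (u + v) < ∞ := by
  obtain ⟨B, hB⟩ := energy_lt_top_iff.1 hu
  obtain ⟨B', hB'⟩ := energy_lt_top_iff.1 hv
  refine energy_lt_top_iff.2 ⟨2 * (B + B'), fun m => ?_⟩
  have h := graphForm_self_nonneg D m (u + -v)
  rw [graphForm_add_left, graphForm_comm _ _ u, graphForm_comm _ _ (-v), graphForm_add_left,
    graphForm_add_left, graphForm_neg_left, graphForm_comm _ _ u (-v), graphForm_neg_left,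
    graphForm_comm _ _ (-v) (-v), graphForm_neg_left, graphForm_comm _ _ v (-v),
    graphForm_neg_left, neg_neg] at h
  rw [graphForm_add_left, graphForm_comm _ _ u, graphForm_comm _ _ v, graphForm_add_left,
    graphForm_add_left]
  linarith [hB m, hB' m, graphForm_comm D m u v]

theorem graphForm_le_graphForm {D : Set Plane} {m : ℕ} {u v u' v' : Plane → ℝ}
    (h : ∀ x ∈ SG, ∀ y ∈ SG, (u x - u y) * (v x - v y) ≤ (u' x - u' y) * (v' x - v' y)) :
    graphForm D m u v ≤ graphForm D m u' v' := by
  classical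
  exact mul_le_mul_of_nonneg_left (Finset.sum_le_sum fun w _ => Finset.sum_le_sum fun i _ =>
    h _ (cellMap_mem_SG w (q_mem_SG _)) _ (cellMap_mem_SG w (q_mem_SG _))) (by positivity)

theorem energy_lt_top_of_abs_sub_le {D : Set Plane} {u v : Plane → ℝ} (hu : energy D u < ∞)
    (h : ∀ x y, |v x - v y| ≤ |u x - u y|) : energy D v < ∞ := by
  refine lt_of_le_of_lt (iSup_mono fun m => ENNReal.ofReal_le_ofReal
    (graphForm_le_graphForm fun x _ y _ => ?_)) hu
  have h1 := mul_self_le_mul_self (abs_nonneg _) (h x y)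
  rwa [abs_mul_abs_self, abs_mul_abs_self] at h1

/-! ### Gluing functions along the cells of level one -/

open Classical in
/-- The function on the gasket that is `g j` read on the cell `F_j SG`; it is well defined there
when the values `g i (q j)` and `g j (q i)` at the common vertices agree. -/
def glue (g : Fin 3 → Plane → ℝ) (x : Plane) : ℝ :=
  if h : ∃ j, ∃ y ∈ SG, F j y = x then g h.choose h.choose_spec.choose else 0

theorem glue_F {g : Fin 3 → Plane → ℝ} (hg : ∀ i j, g i (q j) = g j (q i)) (j : Fin 3)
    {y : Plane} (hy : y ∈ SG) : glue g (F j y) = g j y := by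
  have h : ∃ i, ∃ z ∈ SG, F i z = F j y := ⟨j, y, hy, rfl⟩
  rw [glue, dif_pos h]
  obtain ⟨hz, e⟩ := h.choose_spec.choose_spec
  generalize h.choose_spec.choose = z at hz e
  generalize h.choose = i at hz e
  by_cases hij : i = j
  · subst hij
    rw [F_injective i e]
  · rw [eq_q_of_F_eq hij hz hy e, eq_q_of_F_eq (Ne.symm hij) hy hz e.symm, hg]

theorem continuousOn_glue {g : Fin 3 → Plane → ℝ} (hg : ∀ i j, g i (q j) = g j (q i))
    (hc : ∀ j, ContinuousOn (g j) SG) : ContinuousOn (glue g) SG := by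
  rw [isSelfSimilar_SG.2.2]
  refine (locallyFinite_of_finite _).continuousOn_iUnion
    (fun j => (isCompact_SG.image (continuous_F j)).isClosed) fun j => ?_
  have hinv : ∀ y, (2 : ℝ) • F j y - q j = y := fun y => by
    rw [F, smul_smul]; norm_num
  have h1 : ContinuousOn (fun x : Plane => (2 : ℝ) • x - q j) (F j '' SG) := by fun_prop
  refine ((hc j).comp h1 ?_).congr ?_
  · rintro _ ⟨y, hy, rfl⟩
    change (2 : ℝ) • F j y - q j ∈ SG
    rwa [hinv]
  · rintro _ ⟨y, hy, rfl⟩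
    simp only [Function.comp, hinv, glue_F hg j hy]

theorem energy_glue_lt_top {g : Fin 3 → Plane → ℝ} (hg : ∀ i j, g i (q j) = g j (q i))
    (he : ∀ j, energy SG (g j) < ∞) : energy SG (glue g) < ∞ :=
  energy_lt_top_of_comp_F fun j => by
    rw [energy_congr (u := glue g ∘ F j) (v := g j) (fun y hy => glue_F hg j hy)]
    exact he j

theorem graphForm_glue {g : Fin 3 → Plane → ℝ} (hg : ∀ i j, g i (q j) = g j (q i)) (m : ℕ)
    (u : Plane → ℝ) : graphForm SG (m + 1) u (glue g) =
      5 / 3 * ∑ j, graphForm SG m (u ∘ F j) (g j) := by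
  rw [graphForm_SG_succ]
  congr 1
  exact Finset.sum_congr rfl fun j _ =>
    graphForm_congr (Set.eqOn_refl _ _) (fun y hy => glue_F hg j hy) _ _

/-- The copy of `v` on the cell `F_j SG`, extended by zero to the gasket. This is meaningful if `v`
vanishes at the vertices `q i`, `i ≠ j`, at which `F_j SG` meets the other cells. -/
def zeroExt (j : Fin 3) (v : Plane → ℝ) : Plane → ℝ := glue fun i => if i = j then v else 0

theorem zeroExt_compat {j : Fin 3} {v : Plane → ℝ} (hv : ∀ i, i ≠ j → v (q i) = 0) (i k : Fin 3) :
    (if i = j then v else 0) (q k) = (if k = j then v else 0) (q i) := by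
  split_ifs with h h' h'
  · rw [h, h']
  · simp [hv k h']
  · simp [hv i h]
  · simp

theorem zeroExt_F {j : Fin 3} {v : Plane → ℝ} (hv : ∀ i, i ≠ j → v (q i) = 0) (i : Fin 3)
    {y : Plane} (hy : y ∈ SG) : zeroExt j v (F i y) = if i = j then v y else 0 := by
  rw [zeroExt, glue_F (zeroExt_compat hv) i hy]
  split_ifs <;> rfl

theorem zeroExt_q {j : Fin 3} {v : Plane → ℝ} (hv : ∀ i, i ≠ j → v (q i) = 0) (i : Fin 3) :
    zeroExt j v (q i) = if i = j then v (q j) else 0 := by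
  nth_rw 1 [← F_self i]
  rw [zeroExt_F hv i (q_mem_SG i)]
  split_ifs with h
  · rw [h]
  · rfl

theorem energy_zero (D : Set Plane) : energy D 0 = 0 := by
  simp [energy, graphForm]

theorem energy_zeroExt_lt_top {j : Fin 3} {v : Plane → ℝ} (hv : ∀ i, i ≠ j → v (q i) = 0)
    (he : energy SG v < ∞) : energy SG (zeroExt j v) < ∞ :=
  energy_glue_lt_top (zeroExt_compat hv) fun i => by
    split_ifs
    · exact he
    · rw [energy_zero]; exact ENNReal.zero_lt_top

theorem continuousOn_zeroExt {j : Fin 3} {v : Plane → ℝ} (hv : ∀ i, i ≠ j → v (q i) = 0)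
    (hc : ContinuousOn v SG) : ContinuousOn (zeroExt j v) SG :=
  continuousOn_glue (zeroExt_compat hv) fun i => by
    split_ifs
    · exact hc
    · exact continuousOn_const

theorem graphForm_zeroExt {j : Fin 3} {v : Plane → ℝ} (hv : ∀ i, i ≠ j → v (q i) = 0) (m : ℕ)
    (u : Plane → ℝ) : graphForm SG (m + 1) u (zeroExt j v) =
      5 / 3 * graphForm SG m (u ∘ F j) v := by
  rw [zeroExt, graphForm_glue (zeroExt_compat hv), Finset.sum_eq_single j]
  · rw [if_pos rfl]
  · intro i _ hi
    simp [if_neg hi, graphForm]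
  · simp

/-- If `v` vanishes outside `K`, its zero extension vanishes outside `F_j K`. -/
theorem zeroExt_eq_zero {j : Fin 3} {v : Plane → ℝ} {K : Set Plane}
    (hv : ∀ i, i ≠ j → v (q i) = 0) (hK : ∀ x ∈ SG \ K, v x = 0) :
    ∀ x ∈ SG \ F j '' K, zeroExt j v x = 0 := by
  rintro x ⟨hx, hxK⟩
  obtain ⟨i, y, hy, rfl⟩ := exists_eq_F hx
  rw [zeroExt_F hv i hy]
  split_ifs with h
  · subst h
    exact hK y ⟨hy, fun hyK => hxK ⟨y, hyK, rfl⟩⟩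
  · rfl

/-! ### Harmonic functions on the gasket -/

/-- The vertex values on the cell `F_j SG` of the harmonic function with vertex values `b` (the
`1/5`-`2/5` rule): the value at the vertex between `q i` and `q j` is
`(2 b_i + 2 b_j + b_k) / 5`. -/
def harmStep (j : Fin 3) (b : Fin 3 → ℝ) (i : Fin 3) : ℝ :=
  if i = j then b j else (b i + b j + ∑ l, b l) / 5

theorem harmStep_comm (i j : Fin 3) (b : Fin 3 → ℝ) : harmStep i b j = harmStep j b i := by
  unfold harmStep
  by_cases h : i = j
  · rw [h]
  · rw [if_neg h, if_neg (Ne.symm h), add_comm (b j)]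

/-- The harmonic function on the graph of level `n` with values `b i` at the vertices `q i`,
interpolated affinely on the cells of level `n`. -/
def harmApprox : ℕ → (Fin 3 → ℝ) → Plane → ℝ
  | 0, b => fun x => ∑ i, b i * bary i x
  | n + 1, b => glue fun j => harmApprox n (harmStep j b)

theorem harmApprox_q : ∀ (n : ℕ) (b : Fin 3 → ℝ) (i : Fin 3), harmApprox n b (q i) = b i
  | 0, b, i => by simp [harmApprox, bary_q]
  | n + 1, b, i => by
    rw [← F_self i, harmApprox, glue_F _ _ (q_mem_SG i), harmApprox_q, harmStep, if_pos rfl]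
    intro i j
    rw [harmApprox_q, harmApprox_q, harmStep_comm]

theorem harmApprox_compat (n : ℕ) (b : Fin 3 → ℝ) (i j : Fin 3) :
    harmApprox n (harmStep i b) (q j) = harmApprox n (harmStep j b) (q i) := by
  rw [harmApprox_q, harmApprox_q, harmStep_comm]

theorem harmApprox_succ_F (n : ℕ) (b : Fin 3 → ℝ) (j : Fin 3) {x : Plane} (hx : x ∈ SG) :
    harmApprox (n + 1) b (F j x) = harmApprox n (harmStep j b) x := by
  rw [harmApprox, glue_F (harmApprox_compat n b) j hx]

theorem continuousOn_harmApprox : ∀ (n : ℕ) (b : Fin 3 → ℝ), ContinuousOn (harmApprox n b) SG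
  | 0, _ => (continuous_finsetSum _ fun i _ =>
      continuous_const.mul (continuous_bary i)).continuousOn
  | n + 1, b => continuousOn_glue (harmApprox_compat n b) fun _ => continuousOn_harmApprox n _

theorem abs_harmStep_sub_le {b : Fin 3 → ℝ} {d : ℝ} (hb : ∀ i k, |b i - b k| ≤ d) (j i k : Fin 3) :
    |harmStep j b i - harmStep j b k| ≤ 3 / 5 * d := by
  have h (i k) := abs_le.1 (hb i k)
  have h01 := h 0 1
  have h02 := h 0 2
  have h12 := h 1 2
  unfold harmStep
  rw [Fin.sum_univ_three, abs_le]
  fin_cases j <;> fin_cases i <;> fin_cases k <;>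
    simp only [Fin.zero_eta, Fin.mk_one, Fin.reduceFinMk, Fin.isValue, Fin.reduceEq,
      if_true, if_false] <;> constructor <;> linarith

theorem abs_affine_sub_le {b : Fin 3 → ℝ} {d : ℝ} (hb : ∀ i k, |b i - b k| ≤ d) {x : Plane}
    (hx : x ∈ SG) (k : Fin 3) : |∑ i, b i * bary i x - b k| ≤ d := by
  have hs := sum_bary x
  have e : ∑ i, b i * bary i x - b k = ∑ i, (b i - b k) * bary i x := by
    simp only [Fin.sum_univ_three]
    linear_combination (b k) * hs
  rw [e]
  calc _ ≤ ∑ i, |(b i - b k) * bary i x| := Finset.abs_sum_le_sum_abs _ _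
    _ ≤ ∑ i, d * bary i x := Finset.sum_le_sum fun i _ => by
      rw [abs_mul, abs_of_nonneg (bary_nonneg i hx)]
      exact mul_le_mul_of_nonneg_right (hb i k) (bary_nonneg i hx)
    _ = d := by
      rw [← Finset.mul_sum, Fin.sum_univ_three, hs, mul_one]

theorem dist_harmApprox_succ : ∀ (n : ℕ) {b : Fin 3 → ℝ} {d : ℝ}, (∀ i k, |b i - b k| ≤ d) →
    ∀ x ∈ SG, dist (harmApprox n b x) (harmApprox (n + 1) b x) ≤ 2 * d * (3 / 5) ^ n
  | 0, b, d, hb, x, hx => by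
    obtain ⟨j, y, hy, rfl⟩ := exists_eq_F hx
    rw [harmApprox_succ_F 0 b j hy]
    have h1 := abs_le.1 (abs_affine_sub_le hb (F_mem_SG j hy) j)
    have h2 := abs_le.1 (abs_affine_sub_le (abs_harmStep_sub_le hb j) hy j)
    rw [show harmStep j b j = b j from if_pos rfl] at h2
    have hd : 0 ≤ d := (abs_nonneg _).trans (hb 0 0)
    rw [Real.dist_eq, abs_le, harmApprox, harmApprox]
    constructor <;> linarith
  | n + 1, b, d, hb, x, hx => by
    obtain ⟨j, y, hy, rfl⟩ := exists_eq_F hx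
    rw [harmApprox_succ_F _ b j hy, harmApprox_succ_F _ b j hy]
    refine (dist_harmApprox_succ n (abs_harmStep_sub_le hb j) y hy).trans_eq ?_
    ring

theorem exists_osc_le (b : Fin 3 → ℝ) : ∃ d : ℝ, ∀ i k, |b i - b k| ≤ d :=
  ⟨∑ i, ∑ k, |b i - b k|, fun i k =>
    (Finset.single_le_sum (f := fun k => |b i - b k|) (fun _ _ => abs_nonneg _)
      (Finset.mem_univ k)).trans
    (Finset.single_le_sum (f := fun i => ∑ k, |b i - b k|)
      (fun _ _ => Finset.sum_nonneg fun _ _ => abs_nonneg _) (Finset.mem_univ i))⟩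

/-- The harmonic function on the gasket with values `b i` at the vertices `q i`; its values outside
the gasket carry no information. -/
def harmonicExt (b : Fin 3 → ℝ) (x : Plane) : ℝ := limUnder atTop fun n => harmApprox n b x

theorem tendsto_harmApprox (b : Fin 3 → ℝ) {x : Plane} (hx : x ∈ SG) :
    Tendsto (fun n => harmApprox n b x) atTop (𝓝 (harmonicExt b x)) := by
  obtain ⟨d, hd⟩ := exists_osc_le b
  exact (cauchySeq_of_le_geometric (3 / 5) (2 * d) (by norm_num)
    fun n => dist_harmApprox_succ n hd x hx).tendsto_limUnder

theorem continuousOn_harmonicExt (b : Fin 3 → ℝ) : ContinuousOn (harmonicExt b) SG := by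
  obtain ⟨d, hd⟩ := exists_osc_le b
  have h : TendstoUniformlyOn (fun n => harmApprox n b) (harmonicExt b) atTop SG := by
    refine Metric.tendstoUniformlyOn_iff.2 fun ε hε => ?_
    have h1 : Tendsto (fun n : ℕ => 2 * d * (3 / 5 : ℝ) ^ n / (1 - 3 / 5)) atTop (𝓝 0) := by
      simpa using ((tendsto_pow_atTop_nhds_zero_of_lt_one (r := (3 / 5 : ℝ)) (by norm_num)
        (by norm_num)).const_mul (2 * d)).div_const (1 - 3 / 5)
    filter_upwards [h1.eventually_lt_const hε] with n hn x hx
    rw [dist_comm]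
    exact (dist_le_of_le_geometric_of_tendsto (3 / 5) (2 * d) (by norm_num)
      (fun n => dist_harmApprox_succ n hd x hx) (tendsto_harmApprox b hx) n).trans_lt hn
  exact h.continuousOn (Eventually.of_forall fun n => continuousOn_harmApprox n b).frequently

theorem harmonicExt_q (b : Fin 3 → ℝ) (i : Fin 3) : harmonicExt b (q i) = b i := by
  refine tendsto_nhds_unique (tendsto_harmApprox b (q_mem_SG i)) ?_
  simp only [harmApprox_q]
  exact tendsto_const_nhds

theorem harmonicExt_F (b : Fin 3 → ℝ) (j : Fin 3) {x : Plane} (hx : x ∈ SG) :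
    harmonicExt b (F j x) = harmonicExt (harmStep j b) x := by
  refine tendsto_nhds_unique
    ((tendsto_harmApprox b (F_mem_SG j hx)).comp (tendsto_add_atTop_nat 1)) ?_
  refine (tendsto_harmApprox (harmStep j b) hx).congr fun n => ?_
  exact (harmApprox_succ_F n b j hx).symm

/-- The Gauss-Green formula for harmonic functions: the energy form of a harmonic function and `v`
depends only on the vertex values of the two functions, at every level. -/
theorem graphForm_harmonicExt : ∀ (m : ℕ) (b : Fin 3 → ℝ) (v : Plane → ℝ),
    graphForm SG m (harmonicExt b) v = triForm b (v ∘ q)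
  | 0, b, v => by
    rw [graphForm_zero]
    congr 1
    exact funext (harmonicExt_q b)
  | m + 1, b, v => by
    have h : ∀ j, graphForm SG m (harmonicExt b ∘ F j) (v ∘ F j) =
        triForm (harmStep j b) ((v ∘ F j) ∘ q) := fun j => by
      rw [← graphForm_harmonicExt m]
      exact graphForm_congr (fun x hx => harmonicExt_F b j hx) (Set.eqOn_refl _ _) _ _
    rw [graphForm_SG_succ]
    simp only [h, Fin.sum_univ_three, triForm_eq, Function.comp, F_self, F_comm 1 0, F_comm 2 0,
      F_comm 2 1, harmStep, Fin.isValue, Fin.reduceEq, if_true, if_false]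
    ring

theorem energy_harmonicExt_lt_top (b : Fin 3 → ℝ) : energy SG (harmonicExt b) < ∞ :=
  energy_lt_top_iff.2 ⟨triForm b (harmonicExt b ∘ q), fun m => (graphForm_harmonicExt m b _).le⟩

/-! ### Weakly harmonic functions -/

/-- `u` is weakly harmonic on `U` if its energy with every test function on `U` vanishes. In
contrast to `HasLaplacianOn`, the form is the one of the whole gasket, for which self-similarity
takes a simple form; see `eventually_graphForm_Ω_eq` for the comparison. -/
def IsWeaklyHarmonicOn (U : Set Plane) (u : Plane → ℝ) : Prop :=
  ∀ v, IsTestFunction U v → Tendsto (fun m => graphForm SG m u v) atTop (𝓝 0)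

/-- Close to a compact subset of `Ω` all small cells lie in `Ω`, so that the form of `Ω` and the
form of the whole gasket agree eventually on test functions. -/
theorem eventually_graphForm_Ω_eq (u : Plane → ℝ) {v : Plane → ℝ} (hv : IsTestFunction Ω v) :
    ∀ᶠ m in atTop, graphForm Ω m u v = graphForm SG m u v := by
  classical
  obtain ⟨-, -, K, hKΩ, hK, hvK⟩ := hv
  let O : Set Plane := {x | bary 2 x < bary 1 x ∧ bary 1 x < 1}
  have hO : IsOpen O := (isOpen_lt (continuous_bary 2) (continuous_bary 1)).inter
    (isOpen_lt (continuous_bary 1) continuous_const)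
  have hKO : K ⊆ O := fun x hx => (mem_Ω.1 (hKΩ hx)).2
  obtain ⟨δ, hδ, hδO⟩ := hK.exists_thickening_subset_open hO hKO
  filter_upwards [eventually_cell_small hδ] with m hm
  have key : ∀ w : Fin m → Fin 3, ¬ cell w ⊆ Ω → ∀ i, v (cellMap w (q i)) = 0 := by
    intro w hw i
    refine hvK _ ⟨cellMap_mem_SG w (q_mem_SG i), fun hi => hw fun x hx => ?_⟩
    refine mem_Ω.2 ⟨cell_subset_SG w hx, hδO ?_⟩
    exact Metric.mem_thickening_iff.2 ⟨_, hi, hm w x hx _ (cellMap_q_mem_cell w i)⟩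
  unfold graphForm
  rw [Finset.filter_true_of_mem (s := Finset.univ) (p := fun w : Fin m → Fin 3 => cell w ⊆ SG)
    fun w _ => cell_subset_SG w]
  congr 1
  refine Finset.sum_filter_of_ne fun w _ hw => ?_
  contrapose! hw
  simp [key w hw]

/-- The pullback of a weakly harmonic function to a cell is weakly harmonic: a test function on
the cell can be extended by zero. -/
theorem IsWeaklyHarmonicOn.comp_F {U U' : Set Plane} {u : Plane → ℝ} {j : Fin 3}
    (hu : IsWeaklyHarmonicOn U u) (hU : U' ⊆ F j ⁻¹' U) (hq : ∀ i, i ≠ j → q i ∉ U') :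
    IsWeaklyHarmonicOn U' (u ∘ F j) := by
  rintro v ⟨hc, he, K, hKU, hK, hvK⟩
  have hv : ∀ i, i ≠ j → v (q i) = 0 := fun i hi =>
    hvK _ ⟨q_mem_SG i, fun h => hq i hi (hKU h)⟩
  have h := hu (zeroExt j v) ⟨continuousOn_zeroExt hv hc, energy_zeroExt_lt_top hv he, F j '' K,
    Set.image_subset_iff.2 (hKU.trans hU), hK.image (continuous_F j), zeroExt_eq_zero hv hvK⟩
  have h1 := ((tendsto_add_atTop_iff_nat 1).2 h).const_mul (3 / 5)
  rw [mul_zero] at h1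
  refine h1.congr fun m => ?_
  rw [graphForm_zeroExt hv]
  ring

theorem eq_zero_of_graphForm_eq_zero : ∀ (m : ℕ) {f : Plane → ℝ}, (∀ i, f (q i) = 0) →
    (∀ n, graphForm SG n f f = 0) → ∀ (w : Fin m → Fin 3) (i : Fin 3), f (cellMap w (q i)) = 0
  | 0, _, h0, _, _, i => h0 i
  | m + 1, f, h0, h, w, i => by
    have hj : ∀ j n, graphForm SG n (f ∘ F j) (f ∘ F j) = 0 := fun j n => by
      have h1 := h (n + 1)
      rw [graphForm_SG_succ] at h1
      have h2 : ∑ j, graphForm SG n (f ∘ F j) (f ∘ F j) = 0 := by linarith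
      exact (Finset.sum_eq_zero_iff_of_nonneg
        fun j _ => graphForm_self_nonneg _ _ _).1 h2 j (Finset.mem_univ j)
    refine eq_zero_of_graphForm_eq_zero m (f := f ∘ F (w 0)) (fun i => ?_) (hj _)
      (fun i => w i.succ) i
    have h1 := hj (w 0) 0
    have h2 : (f ∘ F (w 0) ∘ q) (w 0) = 0 := by
      simp only [Function.comp, F_self, h0]
    rw [graphForm_zero, triForm, Finset.sum_eq_zero_iff_of_nonneg
      fun i _ => mul_self_nonneg _] at h1
    have h3 : ∀ i, (f ∘ F (w 0) ∘ q) i = (f ∘ F (w 0) ∘ q) (i + 1) := fun i =>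
      sub_eq_zero.1 (mul_self_eq_zero.1 (h1 i (Finset.mem_univ i)))
    change (f ∘ F (w 0) ∘ q) i = 0
    have h4 : ∀ k, (f ∘ F (w 0) ∘ q) k = (f ∘ F (w 0) ∘ q) 0 := by
      generalize f ∘ F (w 0) ∘ q = g at h3
      intro k
      have h01 : g 0 = g 1 := h3 0
      have h12 : g 1 = g 2 := h3 1
      fin_cases k
      · rfl
      · exact h01.symm
      · exact (h01.trans h12).symm
    rw [h4 i, ← h4 (w 0), h2]

/-- One half of the uniqueness for the Dirichlet problem: a weakly harmonic function with vanishing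
vertex values is nonpositive. Its positive part above a level `ε` is a test function, and its
energy is at most its energy with the function itself. -/
theorem nonpos_of_isWeaklyHarmonicOn {φ : Plane → ℝ} (hc : ContinuousOn φ SG)
    (h0 : ∀ i, φ (q i) = 0)
    (hfin : ∀ (n : ℕ) (w : Fin n → Fin 3), (∀ i, q i ∉ cell w) → energy SG (φ ∘ cellMap w) < ∞)
    (hφ : IsWeaklyHarmonicOn (SG \ V₀) φ) : ∀ x ∈ SG, φ x ≤ 0 := by
  intro x hx
  refine le_of_forall_pos_le_add fun ε hε => ?_
  rw [zero_add]
  let ψ : Plane → ℝ := fun x => max (φ x - ε) 0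
  have hψc : ContinuousOn ψ SG := (hc.sub continuousOn_const).sup continuousOn_const
  have hle : ∀ a b : ℝ, |max (a - ε) 0 - max (b - ε) 0| ≤ |a - b| := fun a b => by
    have := abs_max_sub_max_le_abs (a - ε) (b - ε) 0
    rwa [sub_sub_sub_cancel_right] at this
  have hmul : ∀ a b : ℝ, (max (a - ε) 0 - max (b - ε) 0) * (max (a - ε) 0 - max (b - ε) 0) ≤
      (a - b) * (max (a - ε) 0 - max (b - ε) 0) := fun a b => by
    rcases max_cases (a - ε) 0 with ⟨h1, h2⟩ | ⟨h1, h2⟩ <;>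
      rcases max_cases (b - ε) 0 with ⟨h3, h4⟩ | ⟨h3, h4⟩ <;> rw [h1, h3] <;> nlinarith
  have hψq : ∀ i, ψ (q i) = 0 := fun i => by
    simp only [ψ, h0]
    exact max_eq_right (by linarith)
  have hψe : energy SG ψ < ∞ := by
    -- near the vertices `φ` is below `ε`, so that `ψ` vanishes there
    have hδ : ∀ i, ∃ δ > 0, ∀ y ∈ SG, dist y (q i) < δ → φ y < ε := fun i => by
      obtain ⟨δ, hδ, h⟩ := Metric.continuousWithinAt_iff.1 (hc (q i) (q_mem_SG i)) ε hε
      refine ⟨δ, hδ, fun y hy hd => ?_⟩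
      have := h hy hd
      rw [h0, Real.dist_eq, sub_zero] at this
      exact (le_abs_self _).trans_lt this
    choose δ hδ hφδ using hδ
    obtain ⟨n, hn⟩ := ((eventually_all (ι := Fin 3)).2 fun i =>
      eventually_cell_small (hδ i)).exists
    refine energy_lt_top_of_comp_cellMap n fun w => ?_
    by_cases hw : ∃ i, q i ∈ cell w
    · obtain ⟨i, hi⟩ := hw
      have h : Set.EqOn (ψ ∘ cellMap w) 0 SG := fun y hy => by
        have h1 := hφδ i _ (cellMap_mem_SG w hy) (hn i w _ ⟨y, hy, rfl⟩ _ hi)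
        exact max_eq_right (by linarith)
      rw [energy_congr h, energy_zero]
      exact ENNReal.zero_lt_top
    · push Not at hw
      exact energy_lt_top_of_abs_sub_le (hfin n w hw) fun x y => hle _ _
  have hK : IsCompact {y | y ∈ SG ∧ φ y ∈ Set.Ici ε} :=
    isCompact_SG.of_isClosed_subset
      (hc.preimage_isClosed_of_isClosed isCompact_SG.isClosed isClosed_Ici) fun y hy => hy.1
  have htest : IsTestFunction (SG \ V₀) ψ := by
    refine ⟨hψc, hψe, _, ?_, hK, ?_⟩
    · rintro y ⟨hy, hyε⟩
      refine ⟨hy, ?_⟩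
      rintro ⟨i, rfl⟩
      rw [h0] at hyε
      exact absurd hyε (not_le.2 hε)
    · rintro y ⟨hy, hyK⟩
      have : ¬ ε ≤ φ y := fun h => hyK ⟨hy, h⟩
      exact max_eq_right (by linarith)
  have hzero : ∀ m, graphForm SG m ψ ψ = 0 := fun m => by
    refine le_antisymm ?_ (graphForm_self_nonneg _ _ _)
    refine ge_of_tendsto (hφ ψ htest) ?_
    filter_upwards [eventually_ge_atTop m] with n hn
    exact (graphForm_mono SG ψ hn).trans
      (graphForm_le_graphForm fun x _ y _ => hmul _ _)
  have hψ0 := eqOn_zero_of_vertices hψc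
    (fun m w i => eq_zero_of_graphForm_eq_zero m hψq hzero w i) x hx
  have := le_max_left (φ x - ε) 0
  change ψ x = 0 at hψ0
  simp only [ψ] at hψ0
  linarith

/-- A weakly harmonic function on the gasket is the harmonic function with the same vertex
values. -/
theorem eqOn_harmonicExt {f : Plane → ℝ} (hc : ContinuousOn f SG)
    (hfin : ∀ (n : ℕ) (w : Fin n → Fin 3), (∀ i, q i ∉ cell w) → energy SG (f ∘ cellMap w) < ∞)
    (hf : IsWeaklyHarmonicOn (SG \ V₀) f) : Set.EqOn f (harmonicExt (f ∘ q)) SG := by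
  have hc' : ContinuousOn (f + -harmonicExt (f ∘ q)) SG :=
    hc.add (continuousOn_harmonicExt _).neg
  have h0 : ∀ i, (f + -harmonicExt (f ∘ q)) (q i) = 0 := fun i => by
    simp [harmonicExt_q]
  have hfin' : ∀ (n : ℕ) (w : Fin n → Fin 3), (∀ i, q i ∉ cell w) →
      energy SG ((f + -harmonicExt (f ∘ q)) ∘ cellMap w) < ∞ := fun n w hw =>
    energy_add_lt_top (u := f ∘ cellMap w) (v := -(harmonicExt (f ∘ q) ∘ cellMap w))
      (hfin n w hw) (by
        rw [energy_neg]
        exact energy_comp_cellMap_lt_top (cell_subset_SG w) (energy_harmonicExt_lt_top _))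
  have hw : IsWeaklyHarmonicOn (SG \ V₀) (f + -harmonicExt (f ∘ q)) := fun v hv => by
    refine (hf v hv).congr fun m => ?_
    obtain ⟨-, -, K, hKU, -, hvK⟩ := hv
    have hvq : v ∘ q = 0 := funext fun i => hvK _ ⟨q_mem_SG i, fun h => (hKU h).2 ⟨i, rfl⟩⟩
    rw [graphForm_add_left, graphForm_neg_left, graphForm_harmonicExt, hvq]
    simp [triForm]
  have h1 := nonpos_of_isWeaklyHarmonicOn hc' h0 hfin' hw
  have h2 := nonpos_of_isWeaklyHarmonicOn (φ := -(f + -harmonicExt (f ∘ q))) hc'.neg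
    (fun i => by rw [Pi.neg_apply, h0, neg_zero])
    (fun n w h => by
      change energy SG (-((f + -harmonicExt (f ∘ q)) ∘ cellMap w)) < ∞
      rw [energy_neg]
      exact hfin' n w h)
    (fun v hv => by
      simp only [graphForm_neg_left]
      simpa using (hw v hv).neg)
  intro x hx
  have h3 := h1 x hx
  have h4 := h2 x hx
  simp only [Pi.add_apply, Pi.neg_apply] at h3 h4
  linarith

/-! ### Harmonic functions on the half gasket -/

/-- `u` is continuous on the closed half gasket and harmonic on `Ω`, the two parts of harmonicity
being locally finite energy and the weak equation. No boundary values are prescribed, so that the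
property passes on to `u ∘ F 0`. -/
structure IsHarmonicΩ (u : Plane → ℝ) : Prop where
  continuousOn : ContinuousOn u closedΩ
  energy_lt_top : ∀ (m : ℕ) (w : Fin m → Fin 3), cell w ⊆ Ω → energy SG (u ∘ cellMap w) < ∞
  weak : IsWeaklyHarmonicOn Ω u

theorem isHarmonicΩ_of_hasLaplacianOn {u : Plane → ℝ} (hc : ContinuousOn u closedΩ)
    (h : HasLaplacianOn Ω u fun _ => 0) : IsHarmonicΩ u where
  continuousOn := hc
  energy_lt_top m w hw := energy_comp_cellMap_lt_top subset_rfl (h.2.2.1 m w hw)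
  weak v hv := by
    have h1 := h.2.2.2 v hv
    simp only [zero_mul, integral_zero, neg_zero] at h1
    exact h1.congr' (eventually_graphForm_Ω_eq u hv)

theorem F_zero_mem_Ω {x : Plane} (hx : x ∈ Ω) : F 0 x ∈ Ω := by
  obtain ⟨h, h1, h2⟩ := mem_Ω.1 hx
  refine mem_Ω.2 ⟨F_mem_SG 0 h, ?_⟩
  simp only [bary_F, Fin.isValue, Fin.reduceEq, if_false]
  constructor <;> linarith

theorem F_one_mem_Ω {x : Plane} (hx : x ∈ SG \ V₀) : F 1 x ∈ Ω := by
  refine mem_Ω.2 ⟨F_mem_SG 1 hx.1, ?_⟩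
  simp only [bary_F, Fin.isValue, Fin.reduceEq, if_false, if_true]
  have h1 : bary 1 x < 1 := lt_of_not_ge fun h => hx.2 ⟨1, (eq_q_of_bary hx.1 h).symm⟩
  have h2 : bary 2 x < 1 := lt_of_not_ge fun h => hx.2 ⟨2, (eq_q_of_bary hx.1 h).symm⟩
  have h3 := bary_nonneg 1 hx.1
  constructor <;> linarith

theorem F_zero_mem_closedΩ {x : Plane} (hx : x ∈ SG) : F 0 x ∈ closedΩ ↔ x ∈ closedΩ := by
  simp only [mem_closedΩ, hx, F_mem_SG 0 hx, bary_F, true_and, Fin.isValue, Fin.reduceEq, if_false]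
  constructor <;> intro h <;> linarith

theorem F_one_mem_closedΩ {x : Plane} (hx : x ∈ SG) : F 1 x ∈ closedΩ := by
  refine mem_closedΩ.2 ⟨F_mem_SG 1 hx, ?_⟩
  simp only [bary_F, Fin.isValue, Fin.reduceEq, if_false, if_true]
  have h1 := bary_nonneg 1 hx
  have h2 := bary_le_one 2 hx
  linarith

/-- No cell in the lower right part of the gasket is contained in the closed left half. -/
theorem not_cell_subset {m : ℕ} (w : Fin m → Fin 3) : ¬ cell w ⊆ F 2 ⁻¹' closedΩ := by
  intro hw
  have h (i : Fin 3) : cellMap w (q i) = q 1 := by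
    have hi := cellMap_mem_SG w (q_mem_SG i)
    have h1 := (mem_closedΩ.1 (hw (cellMap_q_mem_cell w i))).2
    simp only [bary_F, Fin.isValue, Fin.reduceEq, if_false, if_true] at h1
    have h3 := bary_nonneg 2 hi
    exact eq_q_of_bary hi (by linarith)
  have h1 := dist_cellMap w (q 0) (q 1)
  rw [h 0, h 1, dist_self] at h1
  have h2 : dist (q 0) (q 1) = 0 := by
    have : (0 : ℝ) < (1 / 2) ^ m := by positivity
    nlinarith [dist_nonneg (x := q 0) (y := q 1)]
  have h3 := congrArg (bary 0) (dist_eq_zero.1 h2)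
  simp [bary_q] at h3

theorem q_notMem_Ω (i : Fin 3) : q i ∉ Ω := fun h => h.1.2 ⟨i, rfl⟩

theorem IsHarmonicΩ.comp_F_zero {u : Plane → ℝ} (hu : IsHarmonicΩ u) : IsHarmonicΩ (u ∘ F 0) where
  continuousOn := hu.continuousOn.comp (continuous_F 0).continuousOn fun _ hx =>
    (F_zero_mem_closedΩ (mem_closedΩ.1 hx).1).2 hx
  energy_lt_top m w hw := by
    refine hu.energy_lt_top (m + 1) (Fin.cons 0 w) ?_
    rw [cell_cons]
    rintro _ ⟨x, hx, rfl⟩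
    exact F_zero_mem_Ω (hw hx)
  weak := hu.weak.comp_F (fun _ hx => F_zero_mem_Ω hx) fun i _ => q_notMem_Ω i

theorem IsHarmonicΩ.iterate {u : Plane → ℝ} (hu : IsHarmonicΩ u) : ∀ k : ℕ,
    IsHarmonicΩ (u ∘ (F 0)^[k])
  | 0 => hu
  | k + 1 => by
    rw [Function.iterate_succ, ← Function.comp_assoc]
    exact (hu.iterate k).comp_F_zero

/-- On the cell `F_1 SG`, a solution is the harmonic function with the same vertex values. -/
theorem IsHarmonicΩ.eqOn_F_one {u : Plane → ℝ} (hu : IsHarmonicΩ u) :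
    Set.EqOn (u ∘ F 1) (harmonicExt (u ∘ F 1 ∘ q)) SG := by
  refine eqOn_harmonicExt ?_ ?_ ?_
  · exact hu.continuousOn.comp (continuous_F 1).continuousOn fun _ hx => F_one_mem_closedΩ hx
  · intro n w hw
    refine hu.energy_lt_top (n + 1) (Fin.cons 1 w) ?_
    rw [cell_cons]
    rintro _ ⟨x, hx, rfl⟩
    refine F_one_mem_Ω ⟨cell_subset_SG w hx, ?_⟩
    rintro ⟨i, rfl⟩
    exact hw i hx
  · exact hu.weak.comp_F (fun _ hx => F_one_mem_Ω hx) fun i _ h => h.2 ⟨i, rfl⟩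

theorem IsHarmonicΩ.graphForm_F_one {u : Plane → ℝ} (hu : IsHarmonicΩ u) (m : ℕ) (v : Plane → ℝ) :
    graphForm SG m (u ∘ F 1) v = triForm (u ∘ F 1 ∘ q) (v ∘ q) := by
  rw [graphForm_congr hu.eqOn_F_one (Set.eqOn_refl v _), graphForm_harmonicExt]

theorem harmonicExt_single_q (j i : Fin 3) :
    harmonicExt (Pi.single j 1) (q i) = if i = j then 1 else 0 := by
  rw [harmonicExt_q, Pi.single_apply]

/-- The normal derivatives of a solution at the common vertex `F_0 q_1` of the cells `F_1 SG` and
`F_0 F_1 SG` cancel. This is seen with a test function that is `1` at this vertex and lives on the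
two cells `F_1 F_0 SG` and `F_0 F_1 F_1 SG`. -/
theorem IsHarmonicΩ.flux {u : Plane → ℝ} (hu : IsHarmonicΩ u) :
    3 * (2 * u (F 0 (q 1)) - u (q 1) - u (F 1 (q 2))) +
      5 * (2 * u (F 0 (q 1)) - u (F 0 (F 0 (q 1))) - u (F 0 (F 1 (q 2)))) = 0 := by
  let e (j : Fin 3) : Plane → ℝ := harmonicExt (Pi.single j 1)
  have he (j : Fin 3) : ∀ i, i ≠ j → e j (q i) = 0 := fun i hi => by
    exact (harmonicExt_single_q j i).trans (if_neg hi)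
  have hej (j : Fin 3) : e j (q j) = 1 := (harmonicExt_single_q j j).trans (if_pos rfl)
  let s (j : Fin 3) : Plane → ℝ := zeroExt j (e j)
  have hsq (j i : Fin 3) : s j (q i) = if i = j then 1 else 0 := by
    exact (zeroExt_q (he j) i).trans (by rw [hej])
  have hs1 : ∀ i, i ≠ 1 → s 1 (q i) = 0 := fun i hi => by rw [hsq, if_neg hi]
  let g : Fin 3 → Plane → ℝ := ![zeroExt 1 (s 1), s 0, 0]
  have hg : ∀ i j, g i (q j) = g j (q i) := by
    intro i j
    fin_cases i <;> fin_cases j <;> simp [g, zeroExt_q hs1, hsq]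
  have hcs (j) : ContinuousOn (s j) SG := continuousOn_zeroExt (he j) (continuousOn_harmonicExt _)
  have hes (j) : energy SG (s j) < ∞ :=
    energy_zeroExt_lt_top (he j) (energy_harmonicExt_lt_top _)
  have hvs (j) : ∀ x ∈ SG \ F j '' SG, s j x = 0 :=
    zeroExt_eq_zero (he j) fun x hx => absurd hx.1 hx.2
  have htest : IsTestFunction Ω (glue g) := by
    refine ⟨continuousOn_glue hg fun j => ?_, energy_glue_lt_top hg fun j => ?_,
      F 0 '' (F 1 '' (F 1 '' SG)) ∪ F 1 '' (F 0 '' SG), ?_, ?_, ?_⟩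
    · fin_cases j
      · exact continuousOn_zeroExt hs1 (hcs 1)
      · exact hcs 0
      · exact continuousOn_const
    · fin_cases j
      · exact energy_zeroExt_lt_top hs1 (hes 1)
      · exact hes 0
      · change energy SG 0 < ∞
        rw [energy_zero]; exact ENNReal.zero_lt_top
    · rintro _ (⟨_, ⟨_, ⟨x, hx, rfl⟩, rfl⟩, rfl⟩ | ⟨_, ⟨x, hx, rfl⟩, rfl⟩)
      · refine mem_Ω.2 ⟨F_mem_SG 0 (F_mem_SG 1 (F_mem_SG 1 hx)), ?_⟩
        simp only [bary_F, Fin.isValue, Fin.reduceEq, if_false, if_true]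
        have h1 := bary_nonneg 1 hx
        have h2 := bary_le_one 1 hx
        have h3 := bary_le_one 2 hx
        constructor <;> linarith
      · refine mem_Ω.2 ⟨F_mem_SG 1 (F_mem_SG 0 hx), ?_⟩
        simp only [bary_F, Fin.isValue, Fin.reduceEq, if_false, if_true]
        have h1 := bary_nonneg 1 hx
        have h2 := bary_le_one 1 hx
        have h3 := bary_le_one 2 hx
        constructor <;> linarith
    · exact (((isCompact_SG.image (continuous_F 1)).image (continuous_F 1)).image
        (continuous_F 0)).union ((isCompact_SG.image (continuous_F 0)).image (continuous_F 1))
    · rintro x ⟨hx, hxK⟩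
      obtain ⟨j, y, hy, rfl⟩ := exists_eq_F hx
      rw [glue_F hg j hy]
      fin_cases j
      · exact zeroExt_eq_zero hs1 (hvs 1) y ⟨hy, fun h => hxK (Or.inl ⟨y, h, rfl⟩)⟩
      · exact hvs 0 y ⟨hy, fun h => hxK (Or.inr ⟨y, h, rfl⟩)⟩
      · rfl
  have hform : ∀ m, graphForm SG (m + 2) u (glue g) =
      5 / 3 * (5 / 3 * triForm ((u ∘ F 0) ∘ F 1 ∘ q) (s 1 ∘ q) +
        triForm (u ∘ F 1 ∘ q) (s 0 ∘ q)) := fun m => by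
    rw [graphForm_glue hg, Fin.sum_univ_three]
    change 5 / 3 * (graphForm SG (m + 1) (u ∘ F 0) (zeroExt 1 (s 1)) +
      graphForm SG (m + 1) (u ∘ F 1) (s 0) + graphForm SG (m + 1) (u ∘ F 2) 0) = _
    rw [graphForm_zeroExt hs1, hu.graphForm_F_one, hu.comp_F_zero.graphForm_F_one,
      graphForm_comm _ _ _ 0]
    simp [graphForm]
  have hlim := (tendsto_add_atTop_iff_nat 2).2 (hu.weak _ htest)
  simp only [hform] at hlim
  have h0 := tendsto_nhds_unique hlim tendsto_const_nhds
  simp only [triForm_eq, Function.comp, hsq, F_self, F_comm 1 0, Fin.isValue, Fin.reduceEq,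
    if_true, if_false] at h0
  linarith

/-! ### The energy of a solution -/

/-- The vertex values of the cell `F_0 ^ k F_1 SG` contribute `(5/3) ^ (k + 1)` times their
triangle energy to the energy of a solution. -/
theorem IsHarmonicΩ.graphForm_closedΩ : ∀ (m : ℕ) {u : Plane → ℝ}, IsHarmonicΩ u →
    graphForm closedΩ m u u = ∑ k ∈ Finset.range m, (5 / 3 : ℝ) ^ (k + 1) *
      triForm (u ∘ (F 0)^[k] ∘ F 1 ∘ q) (u ∘ (F 0)^[k] ∘ F 1 ∘ q)
  | 0, u, _ => by
    classical
    have h : ∀ w : Fin 0 → Fin 3, ¬ cell w ⊆ closedΩ := fun w hw => by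
      have h1 := (mem_closedΩ.1 (hw (cellMap_q_mem_cell w 2))).2
      rw [show cellMap w (q 2) = q 2 from rfl, bary_q, bary_q] at h1
      simp at h1
      norm_num at h1
    unfold graphForm
    rw [Finset.filter_false_of_mem fun w _ => h w]
    simp
  | m + 1, u, hu => by
    classical
    rw [graphForm_succ, Fin.sum_univ_three, Finset.sum_range_succ', mul_add, mul_add]
    have h0 : graphForm (F 0 ⁻¹' closedΩ) m (u ∘ F 0) (u ∘ F 0) =
        graphForm closedΩ m (u ∘ F 0) (u ∘ F 0) :=
      graphForm_congr_set (fun w => forall₂_congr fun x hx =>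
        F_zero_mem_closedΩ (cell_subset_SG w hx)) _ _
    have h1 : graphForm (F 1 ⁻¹' closedΩ) m (u ∘ F 1) (u ∘ F 1) =
        triForm (u ∘ F 1 ∘ q) (u ∘ F 1 ∘ q) := by
      refine Eq.trans ?_ (hu.graphForm_F_one m (u ∘ F 1))
      exact graphForm_congr_set (fun w => ⟨fun _ => cell_subset_SG w,
        fun h x hx => F_one_mem_closedΩ (h hx)⟩) _ _
    have h2 : graphForm (F 2 ⁻¹' closedΩ) m (u ∘ F 2) (u ∘ F 2) = 0 := by
      unfold graphForm
      rw [Finset.filter_false_of_mem fun w _ => not_cell_subset w]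
      simp
    rw [h0, h1, h2, hu.comp_F_zero.graphForm_closedΩ m, Finset.mul_sum, mul_zero, add_zero,
      zero_add, pow_one]
    congr 1
    refine Finset.sum_congr rfl fun k _ => ?_
    rw [pow_succ' _ (k + 1), mul_assoc, Function.iterate_succ' (F 0)]
    rfl

/-! ### Weighted square sums of solutions of the recurrence -/

theorem le_of_le_mul_succ_add {x : ℕ → ℝ} {B : ℝ} (hB : 0 ≤ B)
    (h : ∀ n, x n ≤ 2 / 9 * (x (n + 1) + B)) (hx : Tendsto x atTop (𝓝 0)) : x 0 ≤ B := by
  by_contra! hlt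
  have hge : ∀ n, x 0 ≤ x n := fun n => by
    induction n with
    | zero => exact le_rfl
    | succ n ih => linarith [h n]
  have := ge_of_tendsto' hx hge
  linarith

theorem sum_pow_mul_shift_le {α : ℕ → ℝ} {S : ℝ}
    (hS : ∀ N, ∑ k ∈ Finset.range N, (5 / 3 : ℝ) ^ k * α k ^ 2 ≤ S) (n N : ℕ) :
    ∑ i ∈ Finset.range N, (5 / 3 : ℝ) ^ i * α (i + n) ^ 2 ≤ S := by
  refine le_trans ?_ (hS (n + N))
  rw [Finset.sum_range_add]
  have h : 0 ≤ ∑ k ∈ Finset.range n, (5 / 3 : ℝ) ^ k * α k ^ 2 :=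
    Finset.sum_nonneg fun k _ => by positivity
  refine le_add_of_nonneg_of_le h (Finset.sum_le_sum fun i _ => ?_)
  rw [add_comm i n]
  gcongr
  · norm_num
  · omega

/-- The recurrence has the characteristic roots `3` and `1/5`. For a solution tending to zero,
`e k = 5 σ (k + 1) - σ k` is obtained by summation from infinity with ratio `1/3`, and then `σ` by
summation from `0` with ratio `1/5`; both are bounded for the weight `(5/3) ^ k`. -/
theorem sum_pow_mul_sq_le_of_recurrence {σ α : ℕ → ℝ} {S : ℝ} (h0 : σ 0 = α 0)
    (hrec : ∀ k, 16 * σ (k + 1) = 3 * σ k + 5 * σ (k + 2) + 3 * α (k + 1) + 5 * α (k + 2))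
    (hσ : Tendsto σ atTop (𝓝 0))
    (hS : ∀ N, ∑ k ∈ Finset.range N, (5 / 3 : ℝ) ^ k * α k ^ 2 ≤ S) (N : ℕ) :
    ∑ k ∈ Finset.range N, (5 / 3 : ℝ) ^ k * σ k ^ 2 ≤ 15 * S := by
  have hS0 : 0 ≤ S := by simpa using hS 0
  let e : ℕ → ℝ := fun k => 5 * σ (k + 1) - σ k
  let f : ℕ → ℝ := fun k => 3 * α (k + 1) + 5 * α (k + 2)
  have hef : ∀ k, e k = (e (k + 1) + f k) / 3 := fun k => by
    simp only [e, f]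
    linarith [hrec k]
  have he : Tendsto e atTop (𝓝 0) := by
    simpa using (((tendsto_add_atTop_iff_nat 1).2 hσ).const_mul 5).sub hσ
  have hf : ∀ n N, ∑ i ∈ Finset.range N, (5 / 3 : ℝ) ^ i * f (i + n) ^ 2 ≤ 68 * S := fun n N => by
    have h1 := sum_pow_mul_shift_le hS (n + 1) N
    have h2 := sum_pow_mul_shift_le hS (n + 2) N
    calc _ ≤ ∑ i ∈ Finset.range N, (18 * ((5 / 3 : ℝ) ^ i * α (i + (n + 1)) ^ 2) +
          50 * ((5 / 3 : ℝ) ^ i * α (i + (n + 2)) ^ 2)) := by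
          refine Finset.sum_le_sum fun i _ => ?_
          have h : f (i + n) ^ 2 ≤ 18 * α (i + (n + 1)) ^ 2 + 50 * α (i + (n + 2)) ^ 2 := by
            simp only [f, add_assoc]
            nlinarith [sq_nonneg (3 * α (i + (n + 1)) - 5 * α (i + (n + 2)))]
          have hp : (0 : ℝ) ≤ (5 / 3) ^ i := by positivity
          nlinarith
      _ ≤ 68 * S := by
          rw [Finset.sum_add_distrib, ← Finset.mul_sum, ← Finset.mul_sum]
          linarith
  have hE : ∀ N, ∑ i ∈ Finset.range N, (5 / 3 : ℝ) ^ i * e i ^ 2 ≤ 68 * S := fun N => by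
    refine le_of_le_mul_succ_add
      (x := fun n => ∑ i ∈ Finset.range N, (5 / 3 : ℝ) ^ i * e (i + n) ^ 2)
      (by positivity) (fun n => ?_) ?_
    · calc _ ≤ ∑ i ∈ Finset.range N, 2 / 9 * ((5 / 3 : ℝ) ^ i * e (i + (n + 1)) ^ 2 +
            (5 / 3 : ℝ) ^ i * f (i + n) ^ 2) := by
            refine Finset.sum_le_sum fun i _ => ?_
            have h : e (i + n) ^ 2 ≤ 2 / 9 * (e (i + (n + 1)) ^ 2 + f (i + n) ^ 2) := by
              rw [hef (i + n), add_assoc]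
              nlinarith [sq_nonneg (e (i + (n + 1)) - f (i + n))]
            have hp : (0 : ℝ) ≤ (5 / 3) ^ i := by positivity
            nlinarith
        _ ≤ _ := by
            rw [← Finset.mul_sum, Finset.sum_add_distrib]
            gcongr
            exact hf n N
    · have h (i : ℕ) : Tendsto (fun n => (5 / 3 : ℝ) ^ i * e (i + n) ^ 2) atTop (𝓝 0) := by
        have h1 : Tendsto (fun n => e (i + n)) atTop (𝓝 0) := by
          simpa only [add_comm i] using (tendsto_add_atTop_iff_nat i).2 he
        simpa using (h1.pow 2).const_mul ((5 / 3 : ℝ) ^ i)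
      simpa using tendsto_finsetSum (Finset.range N) fun i _ => h i
  induction N with
  | zero => simpa using hS0
  | succ N ih =>
    have h1 : σ 0 ^ 2 ≤ S := by simpa [h0] using hS 1
    have h2 : ∑ k ∈ Finset.range N, (5 / 3 : ℝ) ^ (k + 1) * σ (k + 1) ^ 2 ≤
        ∑ k ∈ Finset.range N, (2 / 15 * ((5 / 3 : ℝ) ^ k * σ k ^ 2) +
          2 / 15 * ((5 / 3 : ℝ) ^ k * e k ^ 2)) := by
      refine Finset.sum_le_sum fun k _ => ?_
      have h : 5 / 3 * σ (k + 1) ^ 2 ≤ 2 / 15 * σ k ^ 2 + 2 / 15 * e k ^ 2 := by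
        simp only [e]
        nlinarith [sq_nonneg (σ k - (5 * σ (k + 1) - σ k))]
      have hp : (0 : ℝ) ≤ (5 / 3) ^ k := by positivity
      rw [pow_succ (5 / 3 : ℝ) k]
      nlinarith
    rw [Finset.sum_add_distrib, ← Finset.mul_sum, ← Finset.mul_sum] at h2
    have h3 := hE N
    rw [Finset.sum_range_succ', pow_zero, one_mul]
    linarith

/-- A discrete Hardy inequality. For a sequence ending in zero it follows by absorbing the shifted
sum, and the general case is a limit. -/
theorem hardy_sum_le {σ : ℕ → ℝ} {B : ℝ} (hσ : Tendsto σ atTop (𝓝 0))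
    (hB : ∀ N, ∑ k ∈ Finset.range N, (5 / 3 : ℝ) ^ k * (σ (k + 1) - σ k) ^ 2 ≤ B) (N : ℕ) :
    ∑ k ∈ Finset.range N, (5 / 3 : ℝ) ^ k * σ k ^ 2 ≤ 20 * B := by
  have key : ∀ M, ∑ k ∈ Finset.range M, (5 / 3 : ℝ) ^ k * (σ k - σ M) ^ 2 ≤ 20 * B := fun M => by
    have h1 : ∑ k ∈ Finset.range M, (5 / 3 : ℝ) ^ k * (σ k - σ M) ^ 2 ≤
        ∑ k ∈ Finset.range M, (4 / 5 * ((5 / 3 : ℝ) ^ (k + 1) * (σ (k + 1) - σ M) ^ 2) +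
          4 * ((5 / 3 : ℝ) ^ k * (σ (k + 1) - σ k) ^ 2)) := by
      refine Finset.sum_le_sum fun k _ => ?_
      have h : (σ k - σ M) ^ 2 ≤ 4 / 3 * (σ (k + 1) - σ M) ^ 2 + 4 * (σ (k + 1) - σ k) ^ 2 := by
        nlinarith [sq_nonneg ((σ (k + 1) - σ M) + 3 * (σ (k + 1) - σ k))]
      have hp : (0 : ℝ) ≤ (5 / 3) ^ k := by positivity
      rw [pow_succ (5 / 3 : ℝ) k]
      nlinarith
    rw [Finset.sum_add_distrib, ← Finset.mul_sum, ← Finset.mul_sum] at h1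
    have h2 := Finset.sum_range_succ' (fun k => (5 / 3 : ℝ) ^ k * (σ k - σ M) ^ 2) M
    rw [Finset.sum_range_succ] at h2
    simp only [sub_self, pow_zero, one_mul, ne_eq, OfNat.ofNat_ne_zero, not_false_eq_true,
      zero_pow, mul_zero, add_zero] at h2
    have h3 := sq_nonneg (σ 0 - σ M)
    linarith [hB M]
  have hlim : Tendsto (fun M => ∑ k ∈ Finset.range N, (5 / 3 : ℝ) ^ k * (σ k - σ M) ^ 2) atTop
      (𝓝 (∑ k ∈ Finset.range N, (5 / 3 : ℝ) ^ k * (σ k - 0) ^ 2)) :=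
    tendsto_finsetSum _ fun k _ => ((hσ.const_sub (σ k)).pow 2).const_mul _
  simp only [sub_zero] at hlim
  refine le_of_tendsto hlim ?_
  filter_upwards [eventually_ge_atTop N] with M hM
  refine le_trans (Finset.sum_le_sum_of_subset_of_nonneg (Finset.range_mono hM)
    fun k _ _ => by positivity) (key M)

/-- The energy of the triangle with vertex values `σ (k + 1)`, `σ k`, `α (k + 1)`. -/
def cellEnergy (σ α : ℕ → ℝ) (k : ℕ) : ℝ :=
  (σ (k + 1) - σ k) ^ 2 + (σ k - α (k + 1)) ^ 2 + (α (k + 1) - σ (k + 1)) ^ 2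

theorem sum_cellEnergy_le {σ α : ℕ → ℝ} {S : ℝ} (h0 : σ 0 = α 0)
    (hrec : ∀ k, 16 * σ (k + 1) = 3 * σ k + 5 * σ (k + 2) + 3 * α (k + 1) + 5 * α (k + 2))
    (hσ : Tendsto σ atTop (𝓝 0))
    (hS : ∀ N, ∑ k ∈ Finset.range N, (5 / 3 : ℝ) ^ k * α k ^ 2 ≤ S) (N : ℕ) :
    ∑ k ∈ Finset.range N, (5 / 3 : ℝ) ^ (k + 1) * cellEnergy σ α k ≤ 123 * S := by
  have hT := sum_pow_mul_sq_le_of_recurrence h0 hrec hσ hS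
  have h1 := hT N
  have h2 := hT (N + 1)
  have h3 := hS (N + 1)
  rw [Finset.sum_range_succ', pow_zero, one_mul] at h2 h3
  calc _ ≤ ∑ k ∈ Finset.range N, (5 * ((5 / 3 : ℝ) ^ k * σ k ^ 2) +
        3 * ((5 / 3 : ℝ) ^ (k + 1) * σ (k + 1) ^ 2) +
        3 * ((5 / 3 : ℝ) ^ (k + 1) * α (k + 1) ^ 2)) := by
        refine Finset.sum_le_sum fun k _ => ?_
        have h : cellEnergy σ α k ≤ 3 * σ k ^ 2 + 3 * σ (k + 1) ^ 2 + 3 * α (k + 1) ^ 2 := by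
          unfold cellEnergy
          nlinarith [sq_nonneg (σ k + σ (k + 1) + α (k + 1))]
        have hp : (0 : ℝ) ≤ (5 / 3) ^ k := by positivity
        rw [pow_succ (5 / 3 : ℝ) k]
        nlinarith
    _ ≤ 123 * S := by
        rw [Finset.sum_add_distrib, Finset.sum_add_distrib, ← Finset.mul_sum, ← Finset.mul_sum,
          ← Finset.mul_sum]
        linarith [sq_nonneg (σ 0), sq_nonneg (α 0)]

theorem sum_pow_mul_sq_le_of_cellEnergy {σ α : ℕ → ℝ} {B : ℝ} (hσ : Tendsto σ atTop (𝓝 0))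
    (hB : ∀ N, ∑ k ∈ Finset.range N, (5 / 3 : ℝ) ^ (k + 1) * cellEnergy σ α k ≤ B) (N : ℕ) :
    ∑ k ∈ Finset.range N, (5 / 3 : ℝ) ^ k * α k ^ 2 ≤ 70 * B + α 0 ^ 2 := by
  have h1 : ∀ N, ∑ k ∈ Finset.range N, (5 / 3 : ℝ) ^ k * (σ (k + 1) - σ k) ^ 2 ≤ B := fun N => by
    refine (Finset.sum_le_sum fun k _ => ?_).trans (hB N)
    have h : (σ (k + 1) - σ k) ^ 2 ≤ cellEnergy σ α k := by
      unfold cellEnergy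
      linarith [sq_nonneg (σ k - α (k + 1)), sq_nonneg (α (k + 1) - σ (k + 1))]
    gcongr
    · norm_num
    · omega
  have hB0 : 0 ≤ B := by simpa using hB 0
  have hle : ∑ k ∈ Finset.range N, (5 / 3 : ℝ) ^ k * α k ^ 2 ≤
      ∑ k ∈ Finset.range (N + 1), (5 / 3 : ℝ) ^ k * α k ^ 2 :=
    Finset.sum_le_sum_of_subset_of_nonneg (Finset.range_mono N.le_succ) fun k _ _ => by positivity
  refine hle.trans ?_
  rw [Finset.sum_range_succ', pow_zero, one_mul]
  gcongr
  calc _ ≤ ∑ k ∈ Finset.range N, (2 * ((5 / 3 : ℝ) ^ (k + 1) * cellEnergy σ α k) +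
        10 / 3 * ((5 / 3 : ℝ) ^ k * σ k ^ 2)) := by
        refine Finset.sum_le_sum fun k _ => ?_
        have h : α (k + 1) ^ 2 ≤ 2 * cellEnergy σ α k + 2 * σ k ^ 2 := by
          unfold cellEnergy
          nlinarith [sq_nonneg (2 * σ k - α (k + 1)), sq_nonneg (σ (k + 1) - σ k),
            sq_nonneg (α (k + 1) - σ (k + 1))]
        have hp : (0 : ℝ) ≤ (5 / 3) ^ k := by positivity
        rw [pow_succ (5 / 3 : ℝ) k]
        nlinarith
    _ ≤ 70 * B := by
        rw [Finset.sum_add_distrib, ← Finset.mul_sum, ← Finset.mul_sum]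
        linarith [hB N, hardy_sum_le hσ h1 N]

/-! ### Limits at the top vertex -/

theorem tendsto_iterate_F_zero {u : Plane → ℝ} (hu : ContinuousOn u closedΩ) {x : Plane}
    (hx : x ∈ closedΩ) : Tendsto (fun k => u ((F 0)^[k] x)) atTop (𝓝 (u (q 0))) := by
  have hmem : ∀ k, (F 0)^[k] x ∈ closedΩ := fun k => by
    induction k with
    | zero => exact hx
    | succ k ih =>
      rw [Function.iterate_succ_apply']
      exact (F_zero_mem_closedΩ (mem_closedΩ.1 ih).1).2 ih
  have hdist : ∀ k, dist ((F 0)^[k] x) (q 0) = (1 / 2) ^ k * dist x (q 0) := fun k => by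
    induction k with
    | zero => simp
    | succ k ih =>
      rw [Function.iterate_succ_apply']
      have h := dist_F 0 ((F 0)^[k] x) (q 0)
      rw [F_self, ih] at h
      rw [h, pow_succ]
      ring
  have h0 : q 0 ∈ closedΩ := Or.inr (Or.inl (Or.inl rfl))
  refine (hu _ h0).tendsto.comp (tendsto_nhdsWithin_iff.2 ⟨?_, Eventually.of_forall hmem⟩)
  refine tendsto_iff_dist_tendsto_zero.2 ?_
  simp only [hdist]
  exact tendsto_half_pow_mul _

theorem sq_rpow_half_mul (m : ℕ) (t : ℝ) :
    ((5 / 3 : ℝ) ^ ((m : ℝ) / 2) * t) ^ 2 = (5 / 3 : ℝ) ^ m * t ^ 2 := by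
  rw [mul_pow, ← Real.rpow_natCast, ← Real.rpow_mul (by norm_num), ← Real.rpow_natCast _ m]
  norm_num

end HalfGasket

end
open HalfGasket in
theorem theorem3p2 :
    ∃ C : ℝ≥0, ∀ (a : ℕ → ℝ) (A : ℝ) (u : Plane → ℝ),
      Tendsto a atTop (𝓝 A) → ContinuousOn u closedΩ → SolvesBVP a u →
        (energy closedΩ u < ∞ ↔
          Memℓp (fun m : ℕ => (5 / 3 : ℝ) ^ ((m : ℝ) / 2) * (a m - A)) 2) ∧
        energy closedΩ u ≤
          C * ∑' m : ℕ, ENNReal.ofReal (((5 / 3 : ℝ) ^ ((m : ℝ) / 2) * (a m - A)) ^ 2) := by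
  refine ⟨123, fun a A u ha huc ⟨hΔ, hu0, hux⟩ => ?_⟩
  have hu := isHarmonicΩ_of_hasLaplacianOn huc hΔ
  have hx : ∀ k, u ((F 0)^[k] (F 1 (q 2))) = a (k + 1) := fun k => by
    rw [F_comm]
    exact hux (k + 1) (by omega)
  have hA : u (q 0) = A := by
    refine tendsto_nhds_unique
      (tendsto_iterate_F_zero huc (F_one_mem_closedΩ (q_mem_SG 2))) ?_
    simp only [hx]
    exact (tendsto_add_atTop_iff_nat 1).2 ha
  let σ : ℕ → ℝ := fun k => u ((F 0)^[k] (q 1)) - A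
  let α : ℕ → ℝ := fun k => a k - A
  have h0 : σ 0 = α 0 := congrArg (· - A) hu0
  have hσ : Tendsto σ atTop (𝓝 0) := by
    have h := (tendsto_iterate_F_zero huc (x := q 1) (Or.inr (Or.inl (Or.inr rfl)))).sub_const A
    rwa [hA, sub_self] at h
  have hrec : ∀ k, 16 * σ (k + 1) = 3 * σ k + 5 * σ (k + 2) + 3 * α (k + 1) + 5 * α (k + 2) := by
    intro k
    have h := (hu.iterate k).flux
    have h1 := hx (k + 1)
    rw [Function.iterate_succ_apply] at h1
    simp only [Function.comp, hx, h1] at h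
    simp only [σ, α, Function.iterate_succ_apply]
    linarith
  have hform : ∀ m, graphForm closedΩ m u u =
      ∑ k ∈ Finset.range m, (5 / 3 : ℝ) ^ (k + 1) * cellEnergy σ α k := fun m => by
    rw [hu.graphForm_closedΩ m]
    refine Finset.sum_congr rfl fun k _ => ?_
    simp only [triForm_eq, Function.comp, hx, cellEnergy, σ, α, Function.iterate_succ_apply, F_self,
      F_comm 1 0]
    ring
  simp only [sq_rpow_half_mul]
  have hg : ∀ m, 0 ≤ (5 / 3 : ℝ) ^ m * (a m - A) ^ 2 := fun m => by positivity
  have hmem : Memℓp (fun m : ℕ => (5 / 3 : ℝ) ^ ((m : ℝ) / 2) * (a m - A)) 2 ↔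
      Summable fun m : ℕ => (5 / 3 : ℝ) ^ m * (a m - A) ^ 2 := by
    rw [memℓp_gen_iff (by norm_num)]
    simp only [ENNReal.toReal_ofNat, Real.rpow_ofNat, Real.norm_eq_abs, sq_abs, sq_rpow_half_mul]
  have hle : energy closedΩ u ≤
      (123 : ℝ≥0) * ∑' m : ℕ, ENNReal.ofReal ((5 / 3 : ℝ) ^ m * (a m - A) ^ 2) := by
    by_cases htop : ∑' m : ℕ, ENNReal.ofReal ((5 / 3 : ℝ) ^ m * (a m - A) ^ 2) = ∞
    · rw [htop, ENNReal.mul_top (by norm_num)]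
      exact le_top
    · have hS : ∀ N, ∑ k ∈ Finset.range N, (5 / 3 : ℝ) ^ k * α k ^ 2 ≤
          (∑' m : ℕ, ENNReal.ofReal ((5 / 3 : ℝ) ^ m * (a m - A) ^ 2)).toReal := fun N => by
        rw [← ENNReal.ofReal_le_iff_le_toReal htop, ENNReal.ofReal_sum_of_nonneg fun m _ => hg m]
        exact ENNReal.sum_le_tsum _
      refine iSup_le fun m => ?_
      rw [hform m]
      refine (ENNReal.ofReal_le_ofReal (sum_cellEnergy_le h0 hrec hσ hS m)).trans_eq ?_
      rw [ENNReal.ofReal_mul (by norm_num), ENNReal.ofReal_toReal htop]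
      norm_num
  refine ⟨?_, hle⟩
  rw [hmem]
  constructor
  · intro h
    obtain ⟨B, hB⟩ := energy_lt_top_iff.1 h
    simp only [hform] at hB
    exact summable_of_sum_range_le hg (sum_pow_mul_sq_le_of_cellEnergy hσ hB)
  · intro h
    exact hle.trans_lt (ENNReal.mul_lt_top ENNReal.coe_lt_top (h.tsum_ofReal_ne_top).lt_top)
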